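/- **Definitions.** A *plane map* is a proper embedding of a finite connected graph (loops and multiple edges allowed) in the plane, considered up to orientation-preserving homeomorphism; it is *vertex-rooted* if a root vertex is distinguished. A *blossoming map* is a plane map in which every corner of the outer face may carry a sequence of opening or closing stems; a *blossoming tree* is one with a single face. Following the border of the outer face clockwise (outer face on the left), one reads the cyclic contour word, with a letter $e$ for each edge side, $b$ for each opening and $\bar b$ for each closing stem. A *local closure* chooses a factor $b\,e\cdots e\,\bar b$ (with $n\ge 0$ letters $e$) and merges the two stems into an edge, directed from the opening to the closing vertex, with the new bounded face on its right. The *closure* of a blossoming map is obtained by iterating local closures as long as possible. Fix an integer $k\ge 1$. A *$k$-fractional orientation* splits each edge into $k$ units and directs each unit one way or the other (only the numbers of units in the two directions matter; $k=1$ is an ordinary orientation). Each unit counts $1/k$ in in- and outdegrees; an opening stem counts $1$ in the outdegree, a closing stem counts $1$ in the indegree, of its vertex. Closure edges are fully directed from opening to closing vertex. Oriented paths and cycles use edges that are at least partially directed along them; a simple oriented cycle does not use an edge in both directions. The orientation of a vertex-rooted map is *accessible* if there is an oriented path of edges from every vertex to the root vertex, and *minimal* if no simple oriented cycle is counterclockwise,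 i.e. has the outer face on its right. **Statement.** 1. Let $M$ be a vertex-rooted plane map endowed with a minimal accessible $k$-fractional orientation $O$. Then there exists a unique vertex-rooted blossoming tree, endowed with an accessible $k$-fractional orientation, whose closure is $M$ oriented with $O$. (Uniqueness holds for trees with the same vertices and half-edges as $M$.) 2. Conversely, every vertex-rooted blossoming tree with as many opening as closing stems, endowed with an accessible $k$-fractional orientation, has a unique closure; this closure is a vertex-rooted plane map without stems whose orientation is minimal and accessible, and every vertex has the same indegree and the same outdegree in the tree and in its closure. 3. Hence the relation "$M$ is the closure of $T$" defines a bijection between isomorphism classes of vertex-rooted plane maps with a minimal accessible $k$-fractional orientation and isomorphism classes of vertex-rooted blossoming trees with as many opening as closing stems and an accessible $k$-fractional orientation. Corresponding maps and trees have the same distribution of in- and outdegrees: for all $(i,o)$, the same number of vertices of indegree $i$ and outdegree $o$. -/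

import Mathlib

universe u

/-- A vertex-rooted blossoming plane map, given combinatorially: `V` is the set of vertices and `D`
the set of half-edges. A plane map (a connected graph properly embedded in the plane, up to
orientation-preserving homeomorphism) is described by the cyclic order of the half-edges around
each vertex, the pairing of half-edges into edges, and its outer face; planarity is Euler's
relation. A half-edge `d` with `opp d = d` is a stem, opening if `d ∈ opening` and closing
otherwise. A plane map in the ordinary sense is a blossoming map without stems. -/
structure BlossomingMap (V D : Type u) where
  /-- the next half-edge in clockwise order around the same vertex -/
  rot : Equiv.Perm D
  /-- the other half of the same edge; stems are the fixed points -/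
  opp : Equiv.Perm D
  /-- the vertex that carries a half-edge -/
  vert : D → V
  /-- the root vertex -/
  root : V
  /-- the half-edges (and stems) that have the outer face on their left -/
  outer : Set D
  /-- the opening stems -/
  opening : Set D
  opp_opp : ∀ d, opp (opp d) = d
  vert_eq_iff : ∀ d d', vert d = vert d' ↔ rot.SameCycle d d'
  connected : ∀ v w : V,
    Relation.ReflTransGen (fun x y => ∃ d, vert d = x ∧ vert (opp d) = y) v w
  /-- Euler's relation (vertices) + (faces) = (edges) + 2. Walking along `d` (along a stem: out and
  back) and then turning to the next half-edge in clockwise order follows the face on the left of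
  `d`, so faces are the cycles of `d ↦ rot (opp d)`; without any half-edge there is one face. -/
  euler : Nat.card V
      + max 1 (Nat.card (Quotient (Equiv.Perm.SameCycle.setoid (opp.trans rot))))
    = Nat.card {d : D // opp d ≠ d} / 2 + 2
  /-- the outer face is one face -/
  outer_face : ∀ d ∈ outer, ∀ d', d' ∈ outer ↔ Equiv.Perm.SameCycle (opp.trans rot) d d'
  outer_nonempty : Nonempty D → outer.Nonempty
  opening_stem : ∀ d ∈ opening, opp d = d
  /-- stems lie in corners of the outer face -/
  stem_outer : ∀ d, opp d = d → d ∈ outer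

namespace BlossomingMap

variable {V D : Type u}

/-- The next half-edge along the face on the left of `d`. The cycle of this permutation on `outer`
lists edge sides and stems in clockwise order along the border of the outer face: it is the
cyclic contour word. -/
def face (M : BlossomingMap V D) : Equiv.Perm D := M.opp.trans M.rot

/-- The number of faces. -/
noncomputable def numFaces (M : BlossomingMap V D) : ℕ :=
  max 1 (Nat.card (Quotient (Equiv.Perm.SameCycle.setoid M.face)))

/-- The closing stems. -/
def closing (M : BlossomingMap V D) : Set D := {d | M.opp d = d ∧ d ∉ M.opening}

/-- A blossoming tree: a blossoming map with a single face. -/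
def IsTree (M : BlossomingMap V D) : Prop := M.numFaces = 1

/-- A (non-blossoming) map: there are no stems. -/
def IsStemless (M : BlossomingMap V D) : Prop := ∀ d, M.opp d ≠ d

/-- In the cyclic contour word, the opening stem `b` is followed by some number `n ≥ 0` of edge
sides and then by the closing stem `c`: a factor `b e ⋯ e c`. -/
def Closable (M : BlossomingMap V D) (b c : D) : Prop :=
  b ∈ M.opening ∧ c ∈ M.closing ∧
    ∃ n : ℕ, (M.face ^ (n + 1)) b = c ∧ ∀ i < n, M.opp ((M.face ^ (i + 1)) b) ≠ (M.face ^ (i + 1)) b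

/-- `N` is obtained from `M` by one local closure: an opening stem `b` and the closing stem `c`
that follows it are merged into an edge, which, directed from `b` to `c`, has the outer face on its
left (and hence the new bounded face on its right). The other data are unchanged; the outer face
of `N` is determined by `b ∈ N.outer`. -/
def LocalClosure (M N : BlossomingMap V D) : Prop :=
  ∃ b c, M.Closable b c ∧
    N.rot = M.rot ∧ N.vert = M.vert ∧ N.root = M.root ∧
    N.opp b = c ∧ N.opp c = b ∧ (∀ d, d ≠ b → d ≠ c → N.opp d = M.opp d) ∧
    N.opening = M.opening \ {b} ∧ b ∈ N.outer

/-- `N` is the closure of `M`: it is reached by iterating local closures as long as possible. -/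
def IsClosure (M N : BlossomingMap V D) : Prop :=
  Relation.ReflTransGen LocalClosure M N ∧ ∀ b c, ¬ N.Closable b c

end BlossomingMap

/-- A vertex-rooted blossoming plane map with a `k`-fractional orientation: an edge consists of `k`
units, and `weight d` of them are directed along `d` (away from the vertex of `d`), the remaining
ones along `opp d`. For `k = 1` this is an ordinary orientation. Opening and closing stems are
outgoing and incoming half-edges. -/
structure OrientedBlossomingMap (k : ℕ) (V D : Type u) extends BlossomingMap V D where
  weight : D → ℕ
  weight_edge : ∀ d, opp d ≠ d → weight d + weight (opp d) = k
  weight_opening : ∀ d ∈ opening, weight d = k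
  weight_closing : ∀ d, opp d = d → d ∉ opening → weight d = 0

namespace OrientedBlossomingMap

variable {k : ℕ} {V D : Type u}

/-- From every vertex there is an oriented path to the root vertex, along edges that are at least
partially directed in the direction of the path (stems are not edges). -/
def IsAccessible (M : OrientedBlossomingMap k V D) : Prop :=
  ∀ v : V, Relation.ReflTransGen
    (fun x y => ∃ d, M.opp d ≠ d ∧ 0 < M.weight d ∧ M.vert d = x ∧ M.vert (M.opp d) = y) v M.root

/-- `c` is a simple oriented cycle of length `n + 1 ≥ 1` (the indices are cyclic): consecutive
edges, at least partially directed along the cycle, with distinct starting vertices, and no edge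
used in both directions. -/
def IsCircuit (M : OrientedBlossomingMap k V D) {n : ℕ} (c : Fin (n + 1) → D) : Prop :=
  (∀ i, 0 < M.weight (c i)) ∧ (∀ i, M.vert (M.opp (c i)) = M.vert (c (i + 1))) ∧
    Function.Injective (fun i => M.vert (c i)) ∧ ∀ i j, M.opp (c i) ≠ c j

/-- The faces on the left of `x` and of `y` lie on the same side of the cycle `c`: one passes
from `x` to `y` by moving along faces and by crossing edges that do not belong to `c`. -/
def SameSide (M : OrientedBlossomingMap k V D) {n : ℕ} (c : Fin (n + 1) → D) (x y : D) : Prop :=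
  Relation.ReflTransGen
    (fun a b => b = M.face a ∨ (b = M.opp a ∧ a ∉ Set.range c ∧ b ∉ Set.range c)) x y

/-- The outer face is on the right of the cycle `c`, that is, on the same side as the face on the
right of some `c i`, which is the face on the left of `opp (c i)`. -/
def IsCounterclockwise (M : OrientedBlossomingMap k V D) {n : ℕ} (c : Fin (n + 1) → D) : Prop :=
  ∃ i, ∃ x ∈ M.outer, M.SameSide c (M.opp (c i)) x

/-- An orientation is minimal if it has no counterclockwise (simple oriented) cycle. -/
def IsMinimal (M : OrientedBlossomingMap k V D) : Prop :=
  ∀ (n : ℕ) (c : Fin (n + 1) → D), M.IsCircuit c → ¬ M.IsCounterclockwise c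

/-- The oriented map `N` is the closure of `M`. The edges of `M` keep their orientation, and a
closure edge is directed from its opening to its closing stem; since opening and closing stems have
weights `k` and `0`, this says that no weight changes. -/
def IsClosure (M N : OrientedBlossomingMap k V D) : Prop :=
  M.toBlossomingMap.IsClosure N.toBlossomingMap ∧ N.weight = M.weight

/-- Outdegree of `v`: an edge counts `weight / k`, an opening stem `1`, a closing stem `0`. -/
noncomputable def outdeg (M : OrientedBlossomingMap k V D) (v : V) : ℚ :=
  (∑ᶠ d ∈ {d | M.vert d = v}, (M.weight d : ℚ)) / k

open Classical in
/-- The number of units at `d` directed towards the vertex of `d`. -/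
noncomputable def inWeight (M : OrientedBlossomingMap k V D) (d : D) : ℕ :=
  if M.opp d = d then (if d ∈ M.opening then 0 else k) else M.weight (M.opp d)

/-- Indegree of `v`: a closing stem counts `1`, an opening stem `0`. -/
noncomputable def indeg (M : OrientedBlossomingMap k V D) (v : V) : ℚ :=
  (∑ᶠ d ∈ {d | M.vert d = v}, (M.inWeight d : ℚ)) / k

/-- The distribution of in- and outdegrees: the number of vertices with indegree `p.1` and
outdegree `p.2`. -/
noncomputable def degreeDistribution (M : OrientedBlossomingMap k V D) (p : ℚ × ℚ) : ℕ :=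
  Nat.card {v : V // M.indeg v = p.1 ∧ M.outdeg v = p.2}

/-- Isomorphism of vertex-rooted oriented blossoming maps. -/
def Isomorphic {V' D' : Type u} (M : OrientedBlossomingMap k V D)
    (N : OrientedBlossomingMap k V' D') : Prop :=
  ∃ (f : V ≃ V') (g : D ≃ D'),
    (∀ d, g (M.rot d) = N.rot (g d)) ∧ (∀ d, g (M.opp d) = N.opp (g d)) ∧
    (∀ d, f (M.vert d) = N.vert (g d)) ∧ f M.root = N.root ∧
    (∀ d, d ∈ M.outer ↔ g d ∈ N.outer) ∧ (∀ d, d ∈ M.opening ↔ g d ∈ N.opening) ∧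
    ∀ d, M.weight d = N.weight (g d)

/-- A vertex-rooted plane map endowed with a minimal accessible orientation. -/
def IsMinimalAccessibleMap (M : OrientedBlossomingMap k V D) : Prop :=
  M.IsStemless ∧ M.IsMinimal ∧ M.IsAccessible

/-- A vertex-rooted blossoming tree endowed with an accessible orientation. -/
def IsAccessibleTree (M : OrientedBlossomingMap k V D) : Prop :=
  M.IsTree ∧ M.IsAccessible

/-- There are as many opening as closing stems. -/
def HasEqualStems (M : OrientedBlossomingMap k V D) : Prop :=
  Nat.card M.opening = Nat.card M.closing

end OrientedBlossomingMap

/-- A finite vertex-rooted oriented blossoming map, together with its vertices and half-edges. -/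
structure FiniteOrientedMap (k : ℕ) where
  V : Type u
  D : Type u
  finite_V : Finite V
  finite_D : Finite D
  map : OrientedBlossomingMap k V D

namespace FiniteOrientedMap

/-- Two oriented blossoming maps are identified if they are isomorphic. -/
instance setoid (k : ℕ) : Setoid (FiniteOrientedMap.{u} k) where
  r X Y := X.map.Isomorphic Y.map
  iseqv :=
    { refl := fun X => ⟨Equiv.refl _, Equiv.refl _, by simp⟩
      symm := by
        rintro X Y ⟨f, g, h1, h2, h3, h4, h5, h6, h7⟩
        refine ⟨f.symm, g.symm, fun d => ?_, fun d => ?_, fun d => ?_, ?_, fun d => ?_, fun d => ?_,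
          fun d => ?_⟩
        · rw [Equiv.symm_apply_eq, h1, Equiv.apply_symm_apply]
        · rw [Equiv.symm_apply_eq, h2, Equiv.apply_symm_apply]
        · rw [Equiv.symm_apply_eq, h3, Equiv.apply_symm_apply]
        · rw [Equiv.symm_apply_eq, h4]
        · rw [h5, Equiv.apply_symm_apply]
        · rw [h6, Equiv.apply_symm_apply]
        · rw [h7, Equiv.apply_symm_apply]
      trans := by
        rintro X Y Z ⟨f, g, h1, h2, h3, h4, h5, h6, h7⟩ ⟨f', g', h1', h2', h3', h4', h5', h6', h7'⟩
        exact ⟨f.trans f', g.trans g', by simp [h1, h1'], by simp [h2, h2'], by simp [h3, h3'],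
          by simp [h4, h4'], by simp [h5, h5'], by simp [h6, h6'], by simp [h7, h7']⟩ }

/-- Isomorphism classes of vertex-rooted plane maps with a minimal accessible `k`-fractional
orientation. -/
def MapClass (k : ℕ) : Type (u + 1) :=
  {q : Quotient (setoid.{u} k) // ∃ X : FiniteOrientedMap.{u} k,
    X.map.IsMinimalAccessibleMap ∧ q = Quotient.mk _ X}

/-- Isomorphism classes of vertex-rooted blossoming trees with an accessible `k`-fractional
orientation and with as many opening as closing stems. -/
def TreeClass (k : ℕ) : Type (u + 1) :=
  {q : Quotient (setoid.{u} k) // ∃ X : FiniteOrientedMap.{u} k,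
    (X.map.IsAccessibleTree ∧ X.map.HasEqualStems) ∧ q = Quotient.mk _ X}

/-- The class of a map. -/
def mapClass {k : ℕ} (X : FiniteOrientedMap.{u} k) (h : X.map.IsMinimalAccessibleMap) :
    MapClass.{u} k :=
  ⟨Quotient.mk _ X, X, h, rfl⟩

/-- The class of a tree. -/
def treeClass {k : ℕ} (X : FiniteOrientedMap.{u} k)
    (h : X.map.IsAccessibleTree ∧ X.map.HasEqualStems) : TreeClass.{u} k :=
  ⟨Quotient.mk _ X, X, h, rfl⟩

end FiniteOrientedMap

/-! Everything rests on reading a local closure backwards. In `N`, an edge with the outer face on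
the left of its half `b` only, and fully directed along `b`, can be cut into an opening stem `b` and
a closing stem `c`. On faces, cutting or merging is multiplication of the face permutation by `swap
b c`, which joins or splits cycles, so Euler's relation is preserved.

Opening a map. While a minimal map has more than one face, some fully directed edge has the outer
face exactly on its left; otherwise the border of the outer face, followed with that face on the
right, contains a counterclockwise cycle (`exists_full_edge`). If cutting this edge `b` destroys
accessibility, let `A` be the set of vertices that no longer reach the root. The contour leaves `A`
along `b` and must re-enter it, along an edge fully directed into `A`; this edge can be cut instead
(`exists_removable_edge`). Cutting preserves minimality, so iteration ends at an accessible tree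
(`exists_tree`).

Closing a tree. Different local closures commute, so the closure is unique by the Church-Rosser
property; each step uses one stem of each kind, so none is left when the numbers agree. Minimality
comes from a discrete Jordan theorem: in the closure every circulation is the coboundary of a
function on faces, first on the tree and then through each local closure (`ClosesAt.hasPotentials`).
From every face the outer face is reached by crossing edges from the side of weight zero, and the
potential of an oriented cycle never decreases along such moves. Hence the outer face is never on
the right of the cycle.

Uniqueness of the tree. A removable edge of the closure cannot be a tree edge: removing a tree edge
separates a part `A` from the root, and as long as that edge borders the outer face, closure edges
only lead into `A` (`opp_ne_of_removable`). So it is a closure edge, and since it borders the outer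
face it can be assumed to be the last one closed. Two trees with the same closure are therefore also
two trees with the same smaller closure, and induction applies (`eq_of_reflTransGen`). Transport
along renamings carries this over to isomorphism classes. -/

/-! ### Identifying two classes of an equivalence relation -/

namespace Setoid

/-- The setoid obtained by identifying the classes of `a` and `b`. -/
def merge {α : Type*} (r : Setoid α) (a b : α) : Setoid α where
  r x y := r x y ∨ (r x a ∧ r b y) ∨ (r x b ∧ r a y)
  iseqv :=
    { refl := fun x => Or.inl (r.refl x)
      symm := by
        rintro x y (h | ⟨h, h'⟩ | ⟨h, h'⟩)
        · exact Or.inl (r.symm h)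
        · exact Or.inr (Or.inr ⟨r.symm h', r.symm h⟩)
        · exact Or.inr (Or.inl ⟨r.symm h', r.symm h⟩)
      trans := by
        rintro x y z (h | ⟨h, h'⟩ | ⟨h, h'⟩) (g | ⟨g, g'⟩ | ⟨g, g'⟩)
        · exact Or.inl (r.trans h g)
        · exact Or.inr (Or.inl ⟨r.trans h g, g'⟩)
        · exact Or.inr (Or.inr ⟨r.trans h g, g'⟩)
        · exact Or.inr (Or.inl ⟨h, r.trans h' g⟩)
        · exact Or.inr (Or.inl ⟨h, g'⟩)
        · exact Or.inl (r.trans h g')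
        · exact Or.inr (Or.inr ⟨h, r.trans h' g⟩)
        · exact Or.inl (r.trans h g')
        · exact Or.inr (Or.inr ⟨h, g'⟩) }

theorem merge_apply {α : Type*} (r : Setoid α) (a b x y : α) :
    r.merge a b x y ↔ r x y ∨ (r x a ∧ r b y) ∨ (r x b ∧ r a y) := Iff.rfl

theorem le_merge {α : Type*} (r : Setoid α) (a b : α) : r ≤ r.merge a b := fun _ _ h => Or.inl h

theorem merge_rel {α : Type*} (r : Setoid α) (a b : α) : r.merge a b a b :=
  Or.inr (Or.inl ⟨r.refl a, r.refl b⟩)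

theorem merge_le {α : Type*} {r s : Setoid α} {a b : α} (h : r ≤ s) (hab : s a b) :
    r.merge a b ≤ s := by
  rintro x y (g | ⟨g, g'⟩ | ⟨g, g'⟩)
  · exact h g
  · exact s.trans (h g) (s.trans hab (h g'))
  · exact s.trans (h g) (s.trans (s.symm hab) (h g'))

theorem merge_eq_self {α : Type*} {r : Setoid α} {a b : α} (hab : r a b) : r.merge a b = r :=
  le_antisymm (merge_le le_rfl hab) (r.le_merge a b)

/-- Every class of the merged relation is represented by exactly one class of `r` other than that of
`b`. -/
theorem card_quotient_merge {α : Type*} [Finite α] (r : Setoid α) {a b : α} (hab : ¬ r a b) :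
    Nat.card (Quotient (r.merge a b)) + 1 = Nat.card (Quotient r) := by
  classical
  have := Fintype.ofFinite (Quotient r)
  let F : {q : Quotient r // q ≠ Quotient.mk r b} → Quotient (r.merge a b) := fun q =>
    Quotient.map' id (fun _ _ h => r.le_merge a b h) q.1
  have hF : Function.Bijective F := by
    constructor
    · rintro ⟨⟨x⟩, hx⟩ ⟨⟨y⟩, hy⟩ h
      have h1 : ¬ r x b := fun h' => hx (Quotient.sound h')
      have h2 : ¬ r y b := fun h' => hy (Quotient.sound h')
      have h3 : r.merge a b x y := Quotient.exact h
      rcases h3 with h3 | ⟨_, h3⟩ | ⟨h3, _⟩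
      · exact Subtype.ext (Quotient.sound h3)
      · exact absurd (r.symm h3) h2
      · exact absurd h3 h1
    · rintro ⟨x⟩
      by_cases hx : r x b
      · exact ⟨⟨Quotient.mk r a, fun h => hab (Quotient.exact h)⟩,
          Quotient.sound (Or.inr (Or.inl ⟨r.refl a, r.symm hx⟩))⟩
      · exact ⟨⟨Quotient.mk r x, fun h => hx (Quotient.exact h)⟩, rfl⟩
  rw [← Nat.card_eq_of_bijective F hF, Nat.card_eq_fintype_card, Nat.card_eq_fintype_card]
  have h1 := Set.card_ne_eq (Quotient.mk r b)
  have h2 : 0 < Fintype.card (Quotient r) := Fintype.card_pos_iff.2 ⟨Quotient.mk r b⟩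
  have h3 : Fintype.card {q : Quotient r // q ≠ Quotient.mk r b} = Fintype.card (Quotient r) - 1 := by
    convert h1
  omega

end Setoid

/-! ### Cycles of a permutation multiplied by a transposition, and the genus inequality -/

namespace Equiv.Perm

variable {D : Type*}

theorem pow_apply_eq_of_agree {σ τ : Perm D} {x : D} {n : ℕ}
    (h : ∀ i < n, τ ((σ ^ i) x) = σ ((σ ^ i) x)) : (τ ^ n) x = (σ ^ n) x := by
  induction n with
  | zero => rfl
  | succ n ih =>
    rw [pow_succ', pow_succ', Perm.mul_apply, Perm.mul_apply, ih fun i hi => h i (by omega),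
      h n (by omega)]

theorem SameCycle.exists_first_pow [Finite D] {σ : Perm D} {x y : D} (h : σ.SameCycle x y) :
    ∃ n : ℕ, (σ ^ (n + 1)) x = y ∧ ∀ i < n, (σ ^ (i + 1)) x ≠ y := by
  classical
  obtain ⟨i, hi, -, h⟩ := h.exists_pow_eq''
  have hex : ∃ n : ℕ, (σ ^ (n + 1)) x = y := ⟨i - 1, by rwa [Nat.sub_add_cancel hi]⟩
  exact ⟨Nat.find hex, Nat.find_spec hex, fun j hj => Nat.find_min hex hj⟩

/-- An iterate starting at `b` becomes an iterate starting at `a` as long as it avoids both. -/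
theorem mul_swap_pow_apply [DecidableEq D] {σ : Perm D} {a b : D} {n : ℕ}
    (h : ∀ i < n, (σ ^ (i + 1)) b ≠ a ∧ (σ ^ (i + 1)) b ≠ b) :
    ((σ * swap a b) ^ (n + 1)) a = (σ ^ (n + 1)) b := by
  have key : ((σ * swap a b) ^ n) (σ b) = (σ ^ n) (σ b) := by
    refine pow_apply_eq_of_agree fun i hi => ?_
    have := h i hi
    rw [pow_succ, Perm.mul_apply] at this
    rw [Perm.mul_apply, swap_apply_of_ne_of_ne this.1 this.2]
  rw [pow_succ, pow_succ, Perm.mul_apply, Perm.mul_apply, Perm.mul_apply, swap_apply_left, key]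

/-- From `a` the new permutation jumps into the cycle of `b` and follows it, without meeting `a`,
until it arrives at `b`. -/
theorem sameCycle_mul_swap [Finite D] [DecidableEq D] {σ : Perm D} {a b : D}
    (h : ¬ σ.SameCycle a b) : (σ * swap a b).SameCycle a b := by
  obtain ⟨n, hn, hmin⟩ := (SameCycle.refl σ b).exists_first_pow
  refine ⟨((n + 1 : ℕ) : ℤ), ?_⟩
  rw [zpow_natCast, mul_swap_pow_apply fun i hi => ⟨fun h' => h ?_, hmin i hi⟩, hn]
  exact SameCycle.symm ⟨((i + 1 : ℕ) : ℤ), by rw [zpow_natCast, h']⟩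

/-- From `b` the new permutation follows the arc of `σ` that leads from `a` to its first arrival at
`b`. It thus returns to `b` without having met `a`. -/
theorem not_sameCycle_mul_swap [Finite D] [DecidableEq D] {σ : Perm D} {a b : D}
    (hab : a ≠ b) (h : σ.SameCycle a b) : ¬ (σ * swap a b).SameCycle a b := by
  obtain ⟨n, hn, hmin⟩ := h.exists_first_pow
  have hne : ∀ i < n, (σ ^ (i + 1)) a ≠ a := by
    intro i hi h'
    -- A return to `a` after `i + 1` steps would shorten the first arrival at `b`.
    refine hmin (n - i - 1) (by omega) ?_
    rw [← hn, show n + 1 = (n - i - 1 + 1) + (i + 1) by omega, pow_add σ (n - i - 1 + 1),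
      Perm.mul_apply, h']
  have hpow : ∀ j ≤ n, ((σ * swap a b) ^ (j + 1)) b = (σ ^ (j + 1)) a := by
    intro j hj
    rw [swap_comm]
    exact mul_swap_pow_apply fun i hi => ⟨hmin i (by omega), hne i (by omega)⟩
  intro hs
  obtain ⟨m, hm, hmmin⟩ := hs.symm.exists_first_pow
  rcases lt_trichotomy m n with hmn | rfl | hmn
  · exact hne m hmn (by rw [← hpow m hmn.le, hm])
  · exact hab (by rw [← hm, hpow _ le_rfl, hn])
  · refine hmmin (m - n - 1) (by omega) (Eq.trans ?_ hm)
    rw [show m + 1 = (m - n - 1 + 1) + (n + 1) by omega, pow_add _ (m - n - 1 + 1),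
      Perm.mul_apply, hpow n le_rfl, hn]

/-- Lying on a common cycle is the smallest equivalence relation that relates each `x` to `σ x`;
comparisons of cycle partitions reduce to single steps. -/
theorem sameCycle_of_apply {σ : Perm D} {r : Setoid D} (h : ∀ x, r x (σ x)) :
    SameCycle.setoid σ ≤ r := by
  rintro x y ⟨i, rfl⟩
  induction i with
  | zero => exact r.refl _
  | succ i ih =>
    rw [add_comm, zpow_add, zpow_one, Perm.mul_apply]
    exact r.trans ih (h _)
  | pred i ih =>
    refine r.trans ih (r.symm ?_)
    have := h ((σ ^ (-(i : ℤ) - 1)) x)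
    rwa [← Perm.mul_apply, ← zpow_one_add, add_sub_cancel] at this

theorem setoid_mul_swap [Finite D] [DecidableEq D] {σ : Perm D} {a b : D}
    (h : ¬ σ.SameCycle a b) :
    SameCycle.setoid (σ * swap a b) = (SameCycle.setoid σ).merge a b := by
  have hτ := sameCycle_mul_swap h
  refine le_antisymm (sameCycle_of_apply fun x => ?_) (Setoid.merge_le (sameCycle_of_apply ?_) hτ)
  · have h1 : (SameCycle.setoid σ).merge a b x (swap a b x) := by
      by_cases ha : x = a
      · subst ha; rw [swap_apply_left]; exact Setoid.merge_rel _ _ _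
      by_cases hb : x = b
      · subst hb; rw [swap_apply_right]; exact Setoid.symm' _ (Setoid.merge_rel _ _ _)
      rw [swap_apply_of_ne_of_ne ha hb]
    exact Setoid.trans' _ h1 (Setoid.le_merge _ _ _ (⟨1, by simp⟩ : σ.SameCycle _ _))
  · intro x
    have h1 : (σ * swap a b).SameCycle x (swap a b x) := by
      by_cases ha : x = a
      · subst ha; rw [swap_apply_left]; exact hτ
      by_cases hb : x = b
      · subst hb; rw [swap_apply_right]; exact hτ.symm
      rw [swap_apply_of_ne_of_ne ha hb]
    refine h1.trans ⟨1, ?_⟩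
    simp

theorem mul_swap_mul_swap [DecidableEq D] (σ : Perm D) (a b : D) :
    σ * swap a b * swap a b = σ := by
  rw [mul_assoc, swap_mul_self, mul_one]

/-- The number of cycles of a permutation, fixed points included. -/
noncomputable def numCycles (σ : Perm D) : ℕ := Nat.card (Quotient (SameCycle.setoid σ))

theorem numCycles_mul_swap_of_not [Finite D] [DecidableEq D] {σ : Perm D} {a b : D}
    (h : ¬ σ.SameCycle a b) : numCycles (σ * swap a b) + 1 = numCycles σ := by
  rw [numCycles, setoid_mul_swap h, Setoid.card_quotient_merge _ h, numCycles]

theorem numCycles_mul_swap_of_sameCycle [Finite D] [DecidableEq D] {σ : Perm D} {a b : D}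
    (hab : a ≠ b) (h : σ.SameCycle a b) : numCycles (σ * swap a b) = numCycles σ + 1 := by
  have := numCycles_mul_swap_of_not (not_sameCycle_mul_swap hab h)
  rw [mul_swap_mul_swap] at this
  exact this.symm

theorem card_support_mul_swap [Finite D] [DecidableEq D] {α : Perm D} (hα : ∀ d, α (α d) = d)
    {b : D} (hb : α b ≠ b) :
    Nat.card {d // (α * swap b (α b)) d ≠ d} + 2 = Nat.card {d // α d ≠ d} := by
  have e : {d | α d ≠ d} = insert b (insert (α b) {d | (α * swap b (α b)) d ≠ d}) := by
    ext d
    simp only [Set.mem_ofPred_eq, Set.mem_insert_iff, Perm.mul_apply]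
    by_cases h1 : d = b
    · simp [h1, hb]
    by_cases h2 : d = α b
    · simp [h2, hα, hb.symm]
    simp [h1, h2, swap_apply_of_ne_of_ne]
  change Nat.card ({d | (α * swap b (α b)) d ≠ d} : Set D) + 2 = Nat.card ({d | α d ≠ d} : Set D)
  rw [e, Nat.card_coe_set_eq, Nat.card_coe_set_eq, Set.ncard_insert_of_notMem,
    Set.ncard_insert_of_notMem]
  · simp
  · simp [hα, hb.symm]

theorem involutive_mul_swap [DecidableEq D] {α : Perm D} (hα : ∀ d, α (α d) = d) (b d : D) :
    (α * swap b (α b)) ((α * swap b (α b)) d) = d := by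
  by_cases h1 : d = b
  · simp [h1, hα]
  by_cases h2 : d = α b
  · simp [h2]
  have h3 : α d ≠ b := fun h => h2 (by rw [← h, hα])
  have h4 : α d ≠ α b := fun h => h1 (α.injective h)
  simp [swap_apply_of_ne_of_ne, h1, h2, h3, h4, hα]

theorem setoid_eq_merge [Finite D] [DecidableEq D] {α : Perm D}
    (b : D) (hb : α b ≠ b) :
    SameCycle.setoid α = (SameCycle.setoid (α * swap b (α b))).merge b (α b) := by
  have h1 : α.SameCycle b (α b) := ⟨1, by simp⟩
  have := setoid_mul_swap (not_sameCycle_mul_swap hb.symm h1)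
  rwa [mul_swap_mul_swap] at this

theorem sup_setoid_eq_merge [Finite D] [DecidableEq D] (σ : Perm D) {α : Perm D}
    (b : D) (hb : α b ≠ b) :
    SameCycle.setoid σ ⊔ SameCycle.setoid α =
      (SameCycle.setoid σ ⊔ SameCycle.setoid (α * swap b (α b))).merge b (α b) := by
  have h := setoid_eq_merge b hb
  apply le_antisymm
  · refine sup_le (le_sup_left.trans (Setoid.le_merge _ _ _)) ?_
    rw [h]
    exact Setoid.merge_le (le_sup_right.trans (Setoid.le_merge _ _ _)) (Setoid.merge_rel _ _ _)
  · refine Setoid.merge_le (sup_le_sup_left ?_ _)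
      ((le_sup_right : _ ≤ SameCycle.setoid σ ⊔ SameCycle.setoid α) ⟨1, by simp⟩)
    rw [h]
    exact Setoid.le_merge _ _ _

/-- The genus of a combinatorial map is nonnegative. -/
theorem numCycles_add_le [Finite D] (σ : Perm D) : ∀ (n : ℕ) (α : Perm D), (∀ d, α (α d) = d) →
    Nat.card {d // α d ≠ d} = n →
    numCycles σ + numCycles (σ * α) ≤
      n / 2 + 2 * Nat.card (Quotient (SameCycle.setoid σ ⊔ SameCycle.setoid α)) := by
  classical
  intro n
  induction n using Nat.strong_induction_on with
  | _ n ih =>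
  intro α hα hn
  by_cases h : ∃ b, α b ≠ b
  · obtain ⟨b, hb⟩ := h
    have hcard := card_support_mul_swap hα hb
    have := ih _ (by omega) (α * swap b (α b)) (involutive_mul_swap hα b) rfl
    rw [sup_setoid_eq_merge σ b hb]
    have hσ : σ * α = σ * (α * swap b (α b)) * swap b (α b) := by
      rw [mul_assoc, mul_swap_mul_swap]
    rw [hσ]
    -- Restoring the edge either keeps the components, and then creates at most one face, or joins
    -- two components, and then joins two faces as well.
    by_cases hs : (SameCycle.setoid σ ⊔ SameCycle.setoid (α * swap b (α b))) b (α b)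
    · rw [Setoid.merge_eq_self hs]
      have : numCycles (σ * (α * swap b (α b)) * swap b (α b)) ≤
          numCycles (σ * (α * swap b (α b))) + 1 := by
        by_cases hc : (σ * (α * swap b (α b))).SameCycle b (α b)
        · exact (numCycles_mul_swap_of_sameCycle hb.symm hc).le
        · have := numCycles_mul_swap_of_not hc
          omega
      omega
    · have h1 := Setoid.card_quotient_merge _ hs
      have h2 := numCycles_mul_swap_of_not (σ := σ * (α * swap b (α b))) (a := b) (b := α b) (by
        refine fun hc => hs ?_
        refine sameCycle_of_apply (r := SameCycle.setoid σ ⊔ SameCycle.setoid (α * swap b (α b)))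
          (fun x => ?_) hc
        exact Setoid.trans' _ ((le_sup_right : _ ≤ SameCycle.setoid σ ⊔ _) (⟨1, by rw [zpow_one]⟩ :
          (α * swap b (α b)).SameCycle x ((α * swap b (α b)) x)))
          ((le_sup_left : _ ≤ _ ⊔ SameCycle.setoid (α * swap b (α b)))
            (⟨1, by simp⟩ : σ.SameCycle _ _)))
      omega
  · push Not at h
    have h1 : α = 1 := Equiv.ext h
    subst h1
    have : SameCycle.setoid σ ⊔ SameCycle.setoid (1 : Perm D) = SameCycle.setoid σ :=
      sup_eq_left.2 (sameCycle_of_apply fun x => by rw [Perm.one_apply])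
    rw [this, mul_one]
    simp only [numCycles]
    omega

end Equiv.Perm

/-! ### Euler's relation in terms of cycles, and bridges -/

namespace BlossomingMap

open Equiv Equiv.Perm

variable {V D : Type u} {M N : BlossomingMap V D} {b c : D}

theorem face_apply (M : BlossomingMap V D) (d : D) : M.face d = M.rot (M.opp d) := rfl

theorem face_eq_mul (M : BlossomingMap V D) : M.face = M.rot * M.opp := rfl

theorem face_opp (M : BlossomingMap V D) (d : D) : M.face (M.opp d) = M.rot d := by
  rw [face_apply, M.opp_opp]

theorem vert_rot (M : BlossomingMap V D) (d : D) : M.vert (M.rot d) = M.vert d :=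
  ((M.vert_eq_iff _ _).2 ⟨1, by simp⟩).symm

theorem vert_face (M : BlossomingMap V D) (d : D) : M.vert (M.face d) = M.vert (M.opp d) :=
  M.vert_rot _

theorem ext_of (rot : N.rot = M.rot) (opp : N.opp = M.opp) (vert : N.vert = M.vert)
    (root : N.root = M.root) (outer : N.outer = M.outer) (opening : N.opening = M.opening) :
    N = M := by
  cases M
  cases N
  simp_all

theorem mem_outer_iff (hb : b ∈ M.outer) (d : D) : d ∈ M.outer ↔ M.face.SameCycle b d :=
  M.outer_face b hb d

theorem face_mem_outer (M : BlossomingMap V D) (d : D) : M.face d ∈ M.outer ↔ d ∈ M.outer :=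
  ⟨fun h => (mem_outer_iff h d).2 (SameCycle.symm ⟨1, by simp⟩),
    fun h => (mem_outer_iff h _).2 ⟨1, by simp⟩⟩

theorem mem_outer_congr {d d' : D} (h : M.face.SameCycle d d') : d ∈ M.outer ↔ d' ∈ M.outer :=
  ⟨fun hd => (mem_outer_iff hd _).2 h, fun hd => (mem_outer_iff hd _).2 h.symm⟩

theorem vert_surjective [Nonempty D] (M : BlossomingMap V D) : Function.Surjective M.vert := by
  intro v
  obtain ⟨d⟩ := ‹Nonempty D›
  rcases (M.connected v (M.vert d)).cases_head with h | ⟨w, ⟨d', h, -⟩, -⟩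
  · exact ⟨d, h.symm⟩
  · exact ⟨d', h⟩

theorem card_vertices [Nonempty D] (M : BlossomingMap V D) : Nat.card V = numCycles M.rot := by
  refine (Nat.card_eq_of_bijective (Quotient.lift M.vert fun x y h => (M.vert_eq_iff x y).2 h)
    ⟨?_, ?_⟩).symm
  · rintro ⟨x⟩ ⟨y⟩ h
    exact Quotient.sound ((M.vert_eq_iff x y).1 h)
  · intro v
    obtain ⟨d, rfl⟩ := M.vert_surjective v
    exact ⟨Quotient.mk _ d, rfl⟩

theorem numCycles_pos [Finite D] [Nonempty D] (σ : Perm D) : 0 < numCycles σ := by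
  have : Nonempty (Quotient (SameCycle.setoid σ)) := ‹Nonempty D›.map (Quotient.mk _)
  exact Nat.card_pos

theorem euler_numCycles [Finite D] [Nonempty D] (M : BlossomingMap V D) :
    Nat.card V + numCycles M.face = Nat.card {d : D // M.opp d ≠ d} / 2 + 2 := by
  have h := M.euler
  have h1 := numCycles_pos M.face
  rwa [max_eq_right (show 1 ≤ Nat.card (Quotient (SameCycle.setoid (M.opp.trans M.rot))) from h1)]
    at h

/-- Connectedness in terms of half-edges: `rot` and `opp` together act transitively. -/
theorem sup_setoid_rel (M : BlossomingMap V D) (x y : D) :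
    (SameCycle.setoid M.rot ⊔ SameCycle.setoid M.opp) x y := by
  have key : ∀ w, Relation.ReflTransGen (fun x y => ∃ d, M.vert d = x ∧ M.vert (M.opp d) = y)
      (M.vert x) w → ∀ y, M.vert y = w →
        (SameCycle.setoid M.rot ⊔ SameCycle.setoid M.opp) x y := by
    intro w h
    induction h with
    | refl =>
      exact fun y hy => (le_sup_left : SameCycle.setoid M.rot ≤ _ ⊔ SameCycle.setoid M.opp)
        ((M.vert_eq_iff _ _).1 hy.symm)
    | tail _ h ih =>
      obtain ⟨d, hd, hd'⟩ := h
      intro y hy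
      refine Setoid.trans' _ (ih d hd) (Setoid.trans' _
        ((le_sup_right : _ ≤ SameCycle.setoid M.rot ⊔ _)
        (⟨1, by simp⟩ : M.opp.SameCycle d (M.opp d)))
        ((le_sup_left : SameCycle.setoid M.rot ≤ _ ⊔ SameCycle.setoid M.opp)
          ((M.vert_eq_iff _ _).1 (hd'.trans hy.symm))))
  exact key _ (M.connected _ _) y rfl

/-- An edge with the same face on both sides is a bridge. -/
theorem exists_separation [Finite D] (M : BlossomingMap V D) (hb : M.opp b ≠ b)
    (h : M.face.SameCycle b (M.opp b)) :
    ∃ A : Set V, M.vert b ∈ A ∧ M.vert (M.opp b) ∉ A ∧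
      ∀ d, d ≠ b → d ≠ M.opp b → (M.vert d ∈ A ↔ M.vert (M.opp d) ∈ A) := by
  classical
  have : Nonempty D := ⟨b⟩
  set α := M.opp * swap b (M.opp b) with hα
  set r := SameCycle.setoid M.rot ⊔ SameCycle.setoid α with hr
  have hmem : ∀ d, M.vert d ∈ {v | ∃ d, M.vert d = v ∧ r b d} ↔ r b d := by
    intro d
    refine ⟨?_, fun h => ⟨d, rfl, h⟩⟩
    rintro ⟨d', h, h'⟩
    exact r.trans h' ((le_sup_left : SameCycle.setoid M.rot ≤ _ ⊔ SameCycle.setoid α) ((M.vert_eq_iff _ _).1 h))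
  refine ⟨{v | ∃ d, M.vert d = v ∧ r b d}, (hmem b).2 (r.refl b), ?_, fun d h1 h2 => ?_⟩
  · rw [hmem]
    intro hbc
    -- Were the map still connected without the edge, it would have one edge less and one face more
    -- (the common face splits), against the genus inequality with a single component.
    have h1 := sup_setoid_eq_merge M.rot b hb
    rw [← hα, ← hr, Setoid.merge_eq_self hbc] at h1
    have h2 : Nat.card (Quotient r) ≤ 1 := by
      rw [Finite.card_le_one_iff_subsingleton]
      refine ⟨?_⟩
      rintro ⟨x⟩ ⟨y⟩
      exact Quotient.sound (h1 ▸ M.sup_setoid_rel x y)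
    have h3 := numCycles_add_le M.rot _ α (involutive_mul_swap M.opp_opp b) rfl
    rw [← hr] at h3
    have h4 := card_support_mul_swap M.opp_opp hb
    have h5 := numCycles_mul_swap_of_sameCycle hb.symm h
    rw [face_eq_mul, mul_assoc, ← face_eq_mul, ← hα] at h5
    have h6 := M.euler_numCycles
    rw [M.card_vertices] at h6
    rw [← hα] at h4
    omega
  · rw [hmem, hmem]
    have h3 : r d (M.opp d) := (le_sup_right : _ ≤ SameCycle.setoid M.rot ⊔ _)
      (⟨1, by rw [zpow_one, hα, Perm.mul_apply, swap_apply_of_ne_of_ne h1 h2]⟩ : α.SameCycle _ _)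
    exact ⟨fun h => r.trans h h3, fun h => r.trans h (r.symm h3)⟩

/-! ### Local closure as a relation symmetric in what is merged and what is cut -/

/-- `N` is obtained from `M` by merging the opening stem `b` and the closing stem `c`; seen from
`N`, the edge from `b` to `c` has the outer face on its left only and is cut into two stems. -/
structure ClosesAt (M N : BlossomingMap V D) (b c : D) : Prop where
  rot : N.rot = M.rot
  vert : N.vert = M.vert
  root : N.root = M.root
  opp_left : N.opp b = c
  opp_right : N.opp c = b
  opp_of_ne : ∀ d, d ≠ b → d ≠ c → N.opp d = M.opp d
  stem_left : M.opp b = b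
  stem_right : M.opp c = c
  ne : b ≠ c
  opening : M.opening = insert b N.opening
  left_mem : b ∈ N.outer
  right_notMem : c ∉ N.outer

namespace ClosesAt

theorem opp_eq [DecidableEq D] (h : ClosesAt M N b c) : M.opp = N.opp * swap b c := by
  ext d
  by_cases hb : d = b
  · subst hb; simp [h.stem_left, h.opp_right]
  by_cases hc : d = c
  · subst hc; simp [h.stem_right, h.opp_left]
  simp [swap_apply_of_ne_of_ne hb hc, h.opp_of_ne d hb hc]

theorem face_eq [DecidableEq D] (h : ClosesAt M N b c) : M.face = N.face * swap b c := by
  rw [face_eq_mul, h.opp_eq, ← h.rot, ← mul_assoc, ← face_eq_mul]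

theorem face_of_ne (h : ClosesAt M N b c) {d : D} (hb : d ≠ b) (hc : d ≠ c) :
    M.face d = N.face d := by
  rw [face_apply, face_apply, h.rot, h.opp_of_ne d hb hc]

theorem face_left (h : ClosesAt M N b c) : M.face b = N.face c := by
  rw [face_apply, face_apply, h.rot, h.opp_right, h.stem_left]

theorem face_right (h : ClosesAt M N b c) : M.face c = N.face b := by
  rw [face_apply, face_apply, h.rot, h.opp_left, h.stem_right]

theorem left_notMem_opening (h : ClosesAt M N b c) : b ∉ N.opening :=
  fun hb => h.ne ((N.opening_stem b hb).symm.trans h.opp_left)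

theorem right_notMem_opening (h : ClosesAt M N b c) : c ∉ N.opening :=
  fun hb => h.ne ((h.opp_right).symm.trans (N.opening_stem c hb))

theorem left_mem_opening (h : ClosesAt M N b c) : b ∈ M.opening := by
  rw [h.opening]; exact Set.mem_insert _ _

theorem right_mem_closing (h : ClosesAt M N b c) : c ∈ M.closing := by
  refine ⟨h.stem_right, ?_⟩
  rw [h.opening]
  rintro (h' | h')
  · exact h.ne h'.symm
  · exact h.right_notMem_opening h'

theorem opening_eq (h : ClosesAt M N b c) : N.opening = M.opening \ {b} := by
  rw [h.opening, Set.insert_sdiff_self_of_notMem h.left_notMem_opening]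

theorem not_sameCycle (h : ClosesAt M N b c) : ¬ N.face.SameCycle b c := fun h' =>
  h.right_notMem ((mem_outer_iff h.left_mem c).2 h')

theorem mem_outer_iff [Finite D] (h : ClosesAt M N b c) (d : D) :
    d ∈ M.outer ↔ d ∈ N.outer ∨ N.face.SameCycle c d := by
  classical
  have h1 := setoid_mul_swap h.not_sameCycle
  rw [← h.face_eq] at h1
  have h2 : M.face.SameCycle b d ↔ _ := (Setoid.ext_iff.1 h1) b d
  rw [BlossomingMap.mem_outer_iff (M.stem_outer b h.stem_left),
    BlossomingMap.mem_outer_iff h.left_mem, h2, Setoid.merge_apply]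
  change N.face.SameCycle b d ∨ (N.face.SameCycle b b ∧ N.face.SameCycle c d) ∨
    (N.face.SameCycle b c ∧ N.face.SameCycle b d) ↔ _
  have h3 := h.not_sameCycle
  have h4 := SameCycle.refl N.face b
  tauto

theorem outer_subset [Finite D] (h : ClosesAt M N b c) : N.outer ⊆ M.outer := fun d hd =>
  (h.mem_outer_iff d).2 (Or.inl hd)

/-- In `M`, the walk from `b` runs along the face of `c` in `N`. That face is not the outer one, so
it carries no stem, and the first stem met is `c`. -/
theorem closable [Finite D] (h : ClosesAt M N b c) : M.Closable b c := by
  classical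
  refine ⟨h.left_mem_opening, h.right_mem_closing, ?_⟩
  obtain ⟨n, hn, hmin⟩ := (SameCycle.refl N.face c).exists_first_pow
  have hb : ∀ i < n, (N.face ^ (i + 1)) c ≠ b := fun i _ h' =>
    h.not_sameCycle (SameCycle.symm ⟨((i + 1 : ℕ) : ℤ), by rw [zpow_natCast, h']⟩)
  have hpow : ∀ j ≤ n, (M.face ^ (j + 1)) b = (N.face ^ (j + 1)) c := by
    intro j hj
    rw [h.face_eq]
    exact mul_swap_pow_apply fun i hi => ⟨hb i (by omega), hmin i (by omega)⟩
  refine ⟨n, by rw [hpow n le_rfl, hn], fun i hi h' => ?_⟩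
  rw [hpow i hi.le, ← h.opp_of_ne _ (hb i hi) (hmin i hi)] at h'
  refine h.right_notMem ((mem_outer_congr ⟨((i + 1 : ℕ) : ℤ), ?_⟩).2 (N.stem_outer _ h'))
  rw [zpow_natCast]

theorem localClosure [Finite D] (h : ClosesAt M N b c) : M.LocalClosure N :=
  ⟨b, c, h.closable, h.rot, h.vert, h.root, h.opp_left, h.opp_right, h.opp_of_ne,
    h.opening_eq, h.left_mem⟩

theorem eq_of_right [Finite D] {M' : BlossomingMap V D} (h : ClosesAt M N b c)
    (h' : ClosesAt M' N b c) : M = M' := by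
  classical
  refine ext_of (h.rot.symm.trans h'.rot) (h.opp_eq.trans h'.opp_eq.symm)
    (h.vert.symm.trans h'.vert) (h.root.symm.trans h'.root) ?_ (h.opening.trans h'.opening.symm)
  ext d
  rw [h.mem_outer_iff, h'.mem_outer_iff]

theorem eq_of_left {N' : BlossomingMap V D} (h : ClosesAt M N b c)
    (h' : ClosesAt M N' b c) : N = N' := by
  have hopp : N.opp = N'.opp := by
    ext d
    by_cases hb : d = b
    · subst hb; rw [h.opp_left, h'.opp_left]
    by_cases hc : d = c
    · subst hc; rw [h.opp_right, h'.opp_right]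
    rw [h.opp_of_ne d hb hc, h'.opp_of_ne d hb hc]
  refine ext_of (h.rot.trans h'.rot.symm) hopp
    (h.vert.trans h'.vert.symm) (h.root.trans h'.root.symm) ?_
    (h.opening_eq.trans h'.opening_eq.symm)
  ext d
  rw [BlossomingMap.mem_outer_iff h.left_mem, BlossomingMap.mem_outer_iff h'.left_mem,
    face_eq_mul, face_eq_mul, h.rot, h'.rot, hopp]

theorem stem_iff (h : ClosesAt M N b c) (d : D) : M.opp d = d ↔ N.opp d = d ∨ d = b ∨ d = c := by
  by_cases hb : d = b
  · subst hb; simp [h.stem_left]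
  by_cases hc : d = c
  · subst hc; simp [h.stem_right]
  simp [hb, hc, h.opp_of_ne d hb hc]

end ClosesAt

theorem Closable.ne (h : M.Closable b c) : b ≠ c := by
  rintro rfl
  exact h.2.1.2 h.1

theorem Closable.sameCycle (h : M.Closable b c) : M.face.SameCycle b c := by
  obtain ⟨-, -, n, hn, -⟩ := h
  exact ⟨((n + 1 : ℕ) : ℤ), by rw [zpow_natCast, hn]⟩

theorem localClosure_iff [Finite D] : M.LocalClosure N ↔ ∃ b c, ClosesAt M N b c := by
  classical
  refine ⟨?_, fun ⟨b, c, h⟩ => h.localClosure⟩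
  rintro ⟨b, c, h, h1, h2, h3, h4, h5, h6, h7, h8⟩
  have hopp : N.opp = M.opp * swap b c := by
    ext d
    by_cases hb : d = b
    · subst hb; rw [h4, Perm.mul_apply, swap_apply_left, h.2.1.1]
    by_cases hc : d = c
    · subst hc; rw [h5, Perm.mul_apply, swap_apply_right, M.opening_stem b h.1]
    rw [h6 d hb hc, Perm.mul_apply, swap_apply_of_ne_of_ne hb hc]
  refine ⟨b, c, h1, h2, h3, h4, h5, h6, M.opening_stem b h.1, h.2.1.1, h.ne, ?_, h8, ?_⟩
  · rw [h7, Set.insert_sdiff_singleton, Set.insert_eq_of_mem h.1]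
  · rw [BlossomingMap.mem_outer_iff h8, face_eq_mul, h1, hopp, ← mul_assoc, ← face_eq_mul]
    exact not_sameCycle_mul_swap h.ne h.sameCycle

end BlossomingMap

/-! ### Existence of merges and cuts; confluence and termination of the closure -/

namespace BlossomingMap

open Equiv Equiv.Perm

variable {V D : Type u} {M N : BlossomingMap V D} {b c : D}

theorem exists_closesAt [Finite D] (h : M.Closable b c) : ∃ N, ClosesAt M N b c := by
  classical
  have : Nonempty D := ⟨b⟩
  have hb := M.opening_stem b h.1
  have hc := h.2.1.1
  have hne := h.ne
  have hoppb : (M.opp * swap b c) b = c := by simp [hc]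
  have hoppc : (M.opp * swap b c) c = b := by simp [hb]
  have hopp : ∀ d, d ≠ b → d ≠ c → (M.opp * swap b c) d = M.opp d := fun d h1 h2 => by
    simp [swap_apply_of_ne_of_ne h1 h2]
  have hback : M.opp * swap b c * swap b ((M.opp * swap b c) b) = M.opp := by
    rw [hoppb, mul_swap_mul_swap]
  have hinv : ∀ d, (M.opp * swap b c) ((M.opp * swap b c) d) = d := by
    intro d
    by_cases h1 : d = b
    · subst h1; rw [hoppb, hoppc]
    by_cases h2 : d = c
    · subst h2; rw [hoppc, hoppb]
    rw [hopp d h1 h2, hopp _ _ _, M.opp_opp]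
    · exact fun h' => h1 (by rw [← M.opp_opp d, h', hb])
    · exact fun h' => h2 (by rw [← M.opp_opp d, h', hc])
  have hface : (M.opp * swap b c).trans M.rot = M.face * swap b c := rfl
  let N : BlossomingMap V D :=
    { rot := M.rot
      opp := M.opp * swap b c
      vert := M.vert
      root := M.root
      outer := {d | (M.face * swap b c).SameCycle b d}
      opening := M.opening \ {b}
      opp_opp := hinv
      vert_eq_iff := M.vert_eq_iff
      connected := by
        intro v w
        induction M.connected v w with
        | refl => exact Relation.ReflTransGen.refl
        | tail _ h ih =>
          refine ih.trans ?_
          obtain ⟨d, rfl, rfl⟩ := h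
          by_cases h1 : d = b
          · rw [h1, hb]
          by_cases h2 : d = c
          · rw [h2, hc]
          exact Relation.ReflTransGen.single ⟨d, rfl, by rw [hopp d h1 h2]⟩
      euler := by
        have h1 := card_support_mul_swap hinv (b := b) (by rw [hoppb]; exact hne.symm)
        rw [hback] at h1
        have h2 := numCycles_mul_swap_of_sameCycle hne h.sameCycle
        have h3 := M.euler_numCycles
        rw [hface]
        change _ + max 1 (numCycles (M.face * swap b c)) = _
        rw [max_eq_right (numCycles_pos _)]
        omega
      outer_face := fun d hd d' => ⟨fun h => SameCycle.trans (SameCycle.symm hd) h,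
        fun h => SameCycle.trans hd h⟩
      outer_nonempty := fun _ => ⟨b, SameCycle.refl _ _⟩
      opening_stem := by
        rintro d ⟨hd, hdb⟩
        rw [hopp d hdb, M.opening_stem d hd]
        rintro rfl
        exact h.2.1.2 hd
      stem_outer := by
        intro d hd
        by_cases h1 : d = b
        · subst h1; exact SameCycle.refl _ _
        by_cases h2 : d = c
        · subst h2; exact absurd (hoppc.symm.trans hd) hne
        rw [hopp d h1 h2] at hd
        have h3 := setoid_mul_swap (not_sameCycle_mul_swap hne h.sameCycle)
        rw [mul_swap_mul_swap] at h3
        have h4 := (Setoid.ext_iff.1 h3) b d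
        have h5 : (SameCycle.setoid M.face) b d :=
          (BlossomingMap.mem_outer_iff (M.stem_outer b hb) d).1 (M.stem_outer d hd)
        rw [h4, Setoid.merge_apply] at h5
        rcases h5 with h5 | ⟨-, h5⟩ | ⟨-, h5⟩
        · exact h5
        -- The cycle of `c` after the merge is the closed factor of the contour word, which contains
        -- only edge sides besides `c`. A remaining stem cannot lie there.
        · exfalso
          obtain ⟨-, -, n, hn, hstem⟩ := h
          have hns : ∀ i ≤ n, (M.face ^ (i + 1)) b ≠ d := by
            rintro i hi rfl
            rcases hi.lt_or_eq with hi | rfl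
            · exact hstem i hi hd
            · exact h2 hn
          have hnb : ∀ i < n, (M.face ^ (i + 1)) b ≠ b := fun i hi h' =>
            hstem i hi (by rw [h', hb])
          have hnc : ∀ i < n, (M.face ^ (i + 1)) b ≠ c := fun i hi h' =>
            hstem i hi (by rw [h', hc])
          have hpow : ∀ j ≤ n, ((M.face * swap b c) ^ (j + 1)) c = (M.face ^ (j + 1)) b := by
            intro j hj
            rw [swap_comm]
            exact mul_swap_pow_apply fun i hi => ⟨hnc i (by omega), hnb i (by omega)⟩
          obtain ⟨m, hm, hmin⟩ := SameCycle.exists_first_pow h5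
          rcases le_or_gt m n with hmn | hmn
          · exact hns m hmn (by rw [← hpow m hmn, hm])
          · refine hmin (m - n - 1) (by omega) (Eq.trans ?_ hm)
            rw [show m + 1 = (m - n - 1 + 1) + (n + 1) by omega, pow_add _ (m - n - 1 + 1),
              Perm.mul_apply, hpow n le_rfl, hn]
        · exact h5 }
  refine ⟨N, rfl, rfl, rfl, hoppb, hoppc, hopp, hb, hc, hne, ?_, SameCycle.refl _ _, ?_⟩
  · change M.opening = insert b (M.opening \ {b})
    rw [Set.insert_sdiff_singleton, Set.insert_eq_of_mem h.1]
  · exact not_sameCycle_mul_swap hne h.sameCycle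

/-- The inverse construction: the face on the right of `b` is absorbed by the outer face.
Connectedness of the cut map is assumed; in the applications it comes from accessibility or from the
edges of a tree. -/
theorem exists_closesAt_of_connected [Finite D] (hb : b ∈ N.outer) (hc : N.opp b ∉ N.outer)
    (hconn : ∀ v w : V, Relation.ReflTransGen
      (fun x y => ∃ d, d ≠ b ∧ d ≠ N.opp b ∧ N.vert d = x ∧ N.vert (N.opp d) = y) v w) :
    ∃ M, ClosesAt M N b (N.opp b) := by
  classical
  have : Nonempty D := ⟨b⟩
  have hne : b ≠ N.opp b := fun h => hc (h ▸ hb)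
  have hns : ¬ N.face.SameCycle b (N.opp b) := fun h => hc ((mem_outer_iff hb _).2 h)
  have hoppb : (N.opp * swap b (N.opp b)) b = b := by simp [N.opp_opp]
  have hoppc : (N.opp * swap b (N.opp b)) (N.opp b) = N.opp b := by simp
  have hopp : ∀ d, d ≠ b → d ≠ N.opp b → (N.opp * swap b (N.opp b)) d = N.opp d :=
    fun d h1 h2 => by simp [swap_apply_of_ne_of_ne h1 h2]
  have hface : (N.opp * swap b (N.opp b)).trans N.rot = N.face * swap b (N.opp b) := rfl
  have hset := setoid_mul_swap hns
  have hbc : (N.face * swap b (N.opp b)).SameCycle b (N.opp b) := sameCycle_mul_swap hns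
  have hmono : ∀ d ∈ N.outer, (N.face * swap b (N.opp b)).SameCycle b d := fun d hd =>
    ((Setoid.ext_iff.1 hset) b d).2 (Or.inl ((mem_outer_iff hb _).1 hd))
  let M : BlossomingMap V D :=
    { rot := N.rot
      opp := N.opp * swap b (N.opp b)
      vert := N.vert
      root := N.root
      outer := {d | (N.face * swap b (N.opp b)).SameCycle b d}
      opening := insert b N.opening
      opp_opp := involutive_mul_swap N.opp_opp b
      vert_eq_iff := N.vert_eq_iff
      connected := fun v w => Relation.ReflTransGen.mono
        (fun x y ⟨d, h1, h2, h3, h4⟩ => ⟨d, h3, by rw [hopp d h1 h2, h4]⟩) _ _ (hconn v w)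
      euler := by
        have h1 := card_support_mul_swap N.opp_opp hne.symm
        have h2 := numCycles_mul_swap_of_not hns
        have h3 := N.euler_numCycles
        rw [hface]
        change _ + max 1 (numCycles (N.face * swap b (N.opp b))) = _
        rw [max_eq_right (numCycles_pos _)]
        omega
      outer_face := fun d hd d' => ⟨fun h => SameCycle.trans (SameCycle.symm hd) h,
        fun h => SameCycle.trans hd h⟩
      outer_nonempty := fun _ => ⟨b, SameCycle.refl _ _⟩
      opening_stem := by
        rintro d (rfl | hd)
        · exact hoppb
        · have h1 := N.opening_stem d hd
          rw [hopp d _ _, h1]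
          · rintro rfl
            exact hne h1.symm
          · rintro rfl
            exact hne ((N.opp_opp b).symm.trans h1)
      stem_outer := by
        intro d hd
        by_cases h1 : d = b
        · subst h1; exact SameCycle.refl _ _
        by_cases h2 : d = N.opp b
        · subst h2; exact hbc
        rw [hopp d h1 h2] at hd
        exact hmono d (N.stem_outer d hd) }
  exact ⟨M, rfl, rfl, rfl, rfl, N.opp_opp b, fun d h1 h2 => (hopp d h1 h2).symm, hoppb, hoppc, hne,
    rfl, hb, hc⟩

/-- The opening stem that precedes a closing stem is unique. -/
theorem Closable.eq_left {b' : D} (h : M.Closable b c) (h' : M.Closable b' c) : b = b' := by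
  have key : ∀ {b b' : D} {n m : ℕ}, M.opp b = b → n < m → (M.face ^ (n + 1)) b = c →
      (M.face ^ (m + 1)) b' = c →
      ¬ ∀ i < m, M.opp ((M.face ^ (i + 1)) b') ≠ (M.face ^ (i + 1)) b' := by
    intro b b' n m hb hnm hn hm hstem
    have h1 : (M.face ^ (m - n - 1 + 1)) b' = b := by
      apply (M.face ^ (n + 1)).injective
      rw [← Perm.mul_apply, ← pow_add, hn, show n + 1 + (m - n - 1 + 1) = m + 1 by omega, hm]
    exact hstem (m - n - 1) (by omega) (by rw [h1, hb])
  obtain ⟨hb, -, n, hn, hstem⟩ := h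
  obtain ⟨hb', -, m, hm, hstem'⟩ := h'
  rcases lt_trichotomy n m with hnm | rfl | hnm
  · exact absurd hstem' (key (M.opening_stem b hb) hnm hn hm)
  · exact (M.face ^ (n + 1)).injective (hn.trans hm.symm)
  · exact absurd hstem (key (M.opening_stem b' hb') hnm hm hn)

/-- The closing stem that follows an opening stem is unique. -/
theorem Closable.eq_right {c' : D} (h : M.Closable b c) (h' : M.Closable b c') : c = c' := by
  obtain ⟨-, hc, n, hn, hstem⟩ := h
  obtain ⟨-, hc', m, hm, hstem'⟩ := h'
  rcases lt_trichotomy n m with hnm | rfl | hnm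
  · exact absurd (by rw [hn, hc.1]) (hstem' n hnm)
  · exact hn.symm.trans hm
  · exact absurd (by rw [hm, hc'.1]) (hstem m hnm)

/-- Two different closable factors of the contour word have no stem in common, so merging one pair
leaves the walk along the other factor unchanged. -/
theorem ClosesAt.closable_of_ne [Finite D] {N : BlossomingMap V D} {b' c' : D}
    (h : ClosesAt M N b c) (h' : M.Closable b' c') (hne : b' ≠ b) : N.Closable b' c' := by
  have hb : b' ≠ b ∧ b' ≠ c := ⟨hne, by rintro rfl; exact h.right_mem_closing.2 h'.1⟩
  have hc : c' ≠ b ∧ c' ≠ c := ⟨by rintro rfl; exact h'.2.1.2 h.left_mem_opening,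
    by rintro rfl; exact hne (h'.eq_left h.closable)⟩
  obtain ⟨hbo, hco, n, hn, hstem⟩ := h'
  have hns : ∀ i < n, (M.face ^ (i + 1)) b' ≠ b ∧ (M.face ^ (i + 1)) b' ≠ c := by
    refine fun i hi => ⟨fun h' => hstem i hi ?_, fun h' => hstem i hi ?_⟩
    · rw [h', h.stem_left]
    · rw [h', h.stem_right]
  have hpow : ∀ j ≤ n, (N.face ^ (j + 1)) b' = (M.face ^ (j + 1)) b' := by
    intro j hj
    refine pow_apply_eq_of_agree fun i hi => (h.face_of_ne ?_ ?_).symm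
    all_goals
      rcases i with _ | i
      · simp [hb]
      · have := hns i (by omega)
        tauto
  refine ⟨?_, ⟨?_, ?_⟩, n, by rw [hpow n le_rfl, hn], fun i hi => ?_⟩
  · rw [h.opening_eq]
    exact ⟨hbo, hne⟩
  · rw [h.opp_of_ne c' hc.1 hc.2, hco.1]
  · rw [h.opening_eq]
    exact fun h' => hco.2 h'.1
  · rw [hpow i hi.le, h.opp_of_ne _ (hns i hi).1 (hns i hi).2]
    exact hstem i hi

/-- Two different local closures commute. -/
theorem ClosesAt.diamond [Finite D] {N N' : BlossomingMap V D} {b' c' : D}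
    (h : ClosesAt M N b c) (h' : ClosesAt M N' b' c') (hne : b' ≠ b) :
    ∃ P, ClosesAt N P b' c' ∧ ClosesAt N' P b c := by
  classical
  obtain ⟨P, hP⟩ := exists_closesAt (h.closable_of_ne h'.closable hne)
  obtain ⟨Q, hQ⟩ := exists_closesAt (h'.closable_of_ne h.closable hne.symm)
  have hb : b' ≠ c := by
    rintro rfl; exact h.right_mem_closing.2 h'.left_mem_opening
  have hb' : c' ≠ b := by
    rintro rfl; exact h'.right_mem_closing.2 h.left_mem_opening
  have hc : c' ≠ c := by
    rintro rfl; exact hne (h'.closable.eq_left h.closable)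
  have hopp : P.opp = Q.opp := by
    ext d
    by_cases h1 : d = b
    · subst h1; rw [hP.opp_of_ne d hne.symm hb'.symm, h.opp_left, hQ.opp_left]
    by_cases h2 : d = c
    · subst h2; rw [hP.opp_of_ne d hb.symm hc.symm, h.opp_right, hQ.opp_right]
    by_cases h3 : d = b'
    · subst h3; rw [hP.opp_left, hQ.opp_of_ne d h1 h2, h'.opp_left]
    by_cases h4 : d = c'
    · subst h4; rw [hP.opp_right, hQ.opp_of_ne d h1 h2, h'.opp_right]
    rw [hP.opp_of_ne d h3 h4, h.opp_of_ne d h1 h2, hQ.opp_of_ne d h1 h2, h'.opp_of_ne d h3 h4]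
  have hface : P.face = Q.face := by
    rw [face_eq_mul, face_eq_mul, hopp, hP.rot, hQ.rot, h.rot, h'.rot]
  -- Otherwise `b` would lie in the new face of `c'`. The faces of `P` and `Q` agree, so `c'` would
  -- be on the outer face of `Q`, hence on that of `N'`.
  have hbP : b ∈ P.outer := by
    rcases (hP.mem_outer_iff b).1 h.left_mem with hbP | hbP
    · exact hbP
    · exfalso
      rw [hface] at hbP
      have := (BlossomingMap.mem_outer_iff hQ.left_mem c').2 hbP.symm
      exact h'.right_notMem (hQ.outer_subset this)
  refine ⟨P, hP, ?_⟩
  exact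
    { rot := hP.rot.trans (h.rot.trans h'.rot.symm)
      vert := hP.vert.trans (h.vert.trans h'.vert.symm)
      root := hP.root.trans (h.root.trans h'.root.symm)
      opp_left := hopp ▸ hQ.opp_left
      opp_right := hopp ▸ hQ.opp_right
      opp_of_ne := hopp ▸ hQ.opp_of_ne
      stem_left := hQ.stem_left
      stem_right := hQ.stem_right
      ne := h.ne
      opening := by
        have h1 : insert b' N'.opening = insert b' (insert b P.opening) := by
          rw [← h'.opening, h.opening, hP.opening, Set.insert_comm]
        have h2 : b' ∉ insert b P.opening := by
          rintro (h3 | h3)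
          · exact hne h3
          · exact hP.left_notMem_opening h3
        rw [← Set.insert_sdiff_self_of_notMem h'.left_notMem_opening, h1,
          Set.insert_sdiff_self_of_notMem h2]
      left_mem := hbP
      right_notMem := fun hc => h.right_notMem (hP.outer_subset hc) }

theorem localClosure_confluent [Finite D] {N N' : BlossomingMap V D} (h : M.LocalClosure N)
    (h' : M.LocalClosure N') : ∃ P, Relation.ReflGen LocalClosure N P ∧
      Relation.ReflTransGen LocalClosure N' P := by
  obtain ⟨b, c, h⟩ := localClosure_iff.1 h
  obtain ⟨b', c', h'⟩ := localClosure_iff.1 h'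
  by_cases hne : b' = b
  · subst hne
    obtain rfl := h.closable.eq_right h'.closable
    obtain rfl := h.eq_of_left h'
    exact ⟨N, .refl, .refl⟩
  · obtain ⟨P, hP, hP'⟩ := h.diamond h' hne
    exact ⟨P, .single hP.localClosure, .single hP'.localClosure⟩

theorem eq_of_reflTransGen_of_not_closable {P : BlossomingMap V D}
    (h : Relation.ReflTransGen LocalClosure M P) (hM : ∀ b c, ¬ M.Closable b c) : M = P := by
  rcases h.cases_head with h | ⟨Q, ⟨b, c, h, -⟩, -⟩
  · exact h
  · exact absurd h (hM b c)

theorem IsClosure.unique [Finite D] {N N' : BlossomingMap V D} (h : M.IsClosure N)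
    (h' : M.IsClosure N') : N = N' := by
  obtain ⟨P, h1, h2⟩ := Relation.church_rosser (fun _ _ _ => localClosure_confluent) h.1 h'.1
  rw [eq_of_reflTransGen_of_not_closable h1 h.2, eq_of_reflTransGen_of_not_closable h2 h'.2]

theorem exists_isClosure [Finite D] (M : BlossomingMap V D) : ∃ N, M.IsClosure N := by
  suffices ∀ (n : ℕ) (M : BlossomingMap V D), M.opening.ncard = n → ∃ N, M.IsClosure N from
    this _ M rfl
  intro n
  induction n using Nat.strong_induction_on with
  | _ n ih =>
  intro M hn
  by_cases h : ∃ b c, M.Closable b c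
  · obtain ⟨b, c, h⟩ := h
    obtain ⟨N, hN⟩ := exists_closesAt h
    have : N.opening.ncard < n := by
      rw [← hn, hN.opening, Set.ncard_insert_of_notMem hN.left_notMem_opening]
      exact Nat.lt_succ_self _
    obtain ⟨P, hP⟩ := ih _ this N rfl
    exact ⟨P, hP.1.head hN.localClosure, hP.2⟩
  · push Not at h
    exact ⟨M, .refl, h⟩

theorem ClosesAt.closing_eq (h : ClosesAt M N b c) : M.closing = insert c N.closing := by
  ext d
  change (M.opp d = d ∧ d ∉ M.opening) ↔ (d = c ∨ (N.opp d = d ∧ d ∉ N.opening))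
  rw [h.stem_iff, h.opening, Set.mem_insert_iff]
  by_cases hb : d = b
  · subst hb; simp [h.ne, h.opp_left, h.ne.symm]
  by_cases hc : d = c
  · subst hc; simp [h.ne.symm, h.right_notMem_opening]
  simp [hb, hc]

theorem card_closing_add_card_opening [Finite D] (h : Relation.ReflTransGen LocalClosure M N) :
    M.opening.ncard + N.closing.ncard = N.opening.ncard + M.closing.ncard := by
  induction h with
  | refl => rfl
  | tail _ h ih =>
    obtain ⟨b, c, h⟩ := localClosure_iff.1 h
    rw [h.opening, h.closing_eq, Set.ncard_insert_of_notMem h.left_notMem_opening,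
      Set.ncard_insert_of_notMem fun h' => h.ne (h.opp_right.symm.trans h'.1)] at ih
    omega

/-- If there is an opening and a closing stem, then some pair of stems can be merged. -/
theorem exists_closable [Finite D] (hb : b ∈ M.opening) (hc : c ∈ M.closing) :
    ∃ b c, M.Closable b c := by
  classical
  -- Take an opening stem and a later closing stem at minimal distance: a stem in between, of either
  -- kind, would yield a closer pair.
  have hex : ∃ n : ℕ, ∃ b ∈ M.opening, (M.face ^ (n + 1)) b ∈ M.closing := by
    have h := (mem_outer_iff (M.stem_outer b (M.opening_stem b hb)) c).1 (M.stem_outer c hc.1)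
    obtain ⟨n, hn, -⟩ := h.exists_first_pow
    exact ⟨n, b, hb, hn ▸ hc⟩
  obtain ⟨b, hb, hc⟩ := Nat.find_spec hex
  refine ⟨b, _, hb, hc, _, rfl, fun i hi hstem => ?_⟩
  by_cases ho : (M.face ^ (i + 1)) b ∈ M.opening
  · refine Nat.find_min hex (m := Nat.find hex - i - 1) (by omega) ⟨_, ho, ?_⟩
    rwa [← Perm.mul_apply, ← pow_add,
      show Nat.find hex - i - 1 + 1 + (i + 1) = Nat.find hex + 1 by omega]
  · exact Nat.find_min hex hi ⟨b, hb, hstem, ho⟩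

theorem IsClosure.isStemless [Finite D] (h : M.IsClosure N)
    (heq : Nat.card M.opening = Nat.card M.closing) : N.IsStemless := by
  have h1 := card_closing_add_card_opening h.1
  rw [Nat.card_coe_set_eq, Nat.card_coe_set_eq] at heq
  have h2 : N.opening = ∅ ∨ N.closing = ∅ := by
    by_contra! h'
    obtain ⟨⟨b, hb⟩, ⟨c, hc⟩⟩ := h'
    obtain ⟨b, c, hbc⟩ := exists_closable hb hc
    exact h.2 b c hbc
  have h3 : N.opening = ∅ ∧ N.closing = ∅ := by
    rw [← Set.ncard_eq_zero, ← Set.ncard_eq_zero] at h2 ⊢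
    omega
  intro d hd
  by_cases ho : d ∈ N.opening
  · rw [h3.1] at ho
    exact ho
  · have : d ∈ N.closing := ⟨hd, ho⟩
    rw [h3.2] at this
    exact this

theorem card_opening_eq_of_isStemless [Finite D] (h : Relation.ReflTransGen LocalClosure M N)
    (hN : N.IsStemless) : Nat.card M.opening = Nat.card M.closing := by
  have h1 := card_closing_add_card_opening h
  have h2 : N.opening = ∅ := Set.eq_empty_of_forall_notMem fun d hd => hN d (N.opening_stem d hd)
  have h3 : N.closing = ∅ := Set.eq_empty_of_forall_notMem fun d hd => hN d hd.1
  rw [Nat.card_coe_set_eq, Nat.card_coe_set_eq]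
  simpa [h2, h3] using h1

end BlossomingMap

/-! ### The border of the outer face -/

namespace Equiv.Perm

theorem SameCycle.exists_exit {D : Type*} [Finite D] {σ : Perm D} {x y : D} {S : Set D}
    (h : σ.SameCycle x y) (hx : x ∈ S) (hy : y ∉ S) :
    ∃ z, σ.SameCycle x z ∧ z ∈ S ∧ σ z ∉ S := by
  obtain ⟨n, -, -, hn⟩ := h.exists_pow_eq''
  by_contra! hno
  have key : ∀ m : ℕ, (σ ^ m) x ∈ S := by
    intro m
    induction m with
    | zero => exact hx
    | succ m ih =>
      rw [pow_succ', Perm.mul_apply]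
      exact hno _ ⟨m, by rw [zpow_natCast]⟩ ih
  exact hy (hn ▸ key n)

end Equiv.Perm

namespace BlossomingMap

open Equiv Equiv.Perm

variable {V D : Type u} {M N : BlossomingMap V D}

theorem isTree_of_sameCycle [Finite D] (h : ∀ x y, M.face.SameCycle x y) : M.IsTree := by
  have h1 : Nat.card (Quotient (SameCycle.setoid M.face)) ≤ 1 := by
    rw [Finite.card_le_one_iff_subsingleton]
    refine ⟨?_⟩
    rintro ⟨y⟩ ⟨z⟩
    exact Quotient.sound (h y z)
  exact max_eq_left h1

/-- The set `outer` is then stable under `opp` and under `face`, hence under `rot`; by connectedness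
it is everything. -/
theorem isTree_of_opp_mem_outer [Finite D] (h : ∀ d ∈ M.outer, M.opp d ∈ M.outer) : M.IsTree := by
  rcases isEmpty_or_nonempty D with hD | hD
  · have : IsEmpty (Quotient (SameCycle.setoid M.face)) := ⟨fun q => q.inductionOn hD.false⟩
    rw [IsTree, numFaces, Nat.card_of_isEmpty]
    rfl
  have hopp : ∀ d, M.opp d ∈ M.outer ↔ d ∈ M.outer := fun d =>
    ⟨fun h' => M.opp_opp d ▸ h _ h', h d⟩
  obtain ⟨x, hx⟩ := M.outer_nonempty hD
  let r : Setoid D := Setoid.ker fun d => d ∈ M.outer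
  have hr : SameCycle.setoid M.rot ⊔ SameCycle.setoid M.opp ≤ r := by
    refine sup_le (sameCycle_of_apply fun d => ?_) (sameCycle_of_apply fun d => ?_)
    · have h1 : M.rot d ∈ M.outer ↔ d ∈ M.outer := by rw [← face_opp, face_mem_outer, hopp]
      exact propext h1.symm
    · exact propext (hopp d).symm
  have hall : ∀ y, M.face.SameCycle x y := fun y => by
    have h1 : (x ∈ M.outer) = (y ∈ M.outer) := hr (M.sup_setoid_rel x y)
    exact (mem_outer_iff hx y).1 (h1 ▸ hx)
  exact isTree_of_sameCycle fun y z => (hall y).symm.trans (hall z)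

theorem IsTree.sameCycle [Finite D] (h : M.IsTree) (x y : D) : M.face.SameCycle x y := by
  have h1 : Nat.card (Quotient (SameCycle.setoid M.face)) ≤ 1 := max_eq_left_iff.1 h
  rw [Finite.card_le_one_iff_subsingleton] at h1
  exact Quotient.exact (Subsingleton.elim (Quotient.mk (SameCycle.setoid M.face) x)
    (Quotient.mk _ y))

theorem IsTree.mem_outer [Finite D] (h : M.IsTree) (x : D) : x ∈ M.outer := by
  obtain ⟨y, hy⟩ := M.outer_nonempty ⟨x⟩
  exact (mem_outer_iff hy x).2 (h.sameCycle y x)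

/-- The next border edge with the outer face on its right. Rotating from the successor of `opp d`,
which is off the outer face, around to `opp d`, which is on it, the last half-edge before the outer
face is entered will do. -/
theorem exists_succ_of_border [Finite D] {d : D} (hd : d ∉ M.outer) (hd' : M.opp d ∈ M.outer) :
    ∃ d', (d' ∉ M.outer ∧ M.opp d' ∈ M.outer) ∧ M.vert d' = M.vert (M.opp d) := by
  have hrot : ∀ x, M.rot x ∈ M.outer ↔ M.opp x ∈ M.outer := fun x => by
    rw [← face_opp, face_mem_outer]
  have h1 : M.rot.SameCycle (M.rot (M.opp d)) (M.opp d) := SameCycle.symm ⟨1, by simp⟩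
  obtain ⟨z, hz, hz1, hz2⟩ := h1.exists_exit (S := M.outerᶜ)
    (by rw [Set.mem_compl_iff, hrot, M.opp_opp]; exact hd) (fun h => h hd')
  refine ⟨z, ⟨hz1, (hrot z).1 (not_not.1 hz2)⟩, ?_⟩
  rw [← (M.vert_eq_iff _ _).2 hz, M.vert_rot]

end BlossomingMap

/-! ### Orientations, and the opening of a minimal accessible map -/

namespace OrientedBlossomingMap

open Equiv Equiv.Perm BlossomingMap

variable {k : ℕ} {V D : Type u} {M N : OrientedBlossomingMap k V D} {b c : D}

theorem ext_of (h : M.toBlossomingMap = N.toBlossomingMap) (hw : M.weight = N.weight) : M = N := by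
  cases M
  cases N
  simp_all

/-- Indegrees thus depend only on `vert` and `weight`, which a closure does not change. -/
theorem inWeight_eq (M : OrientedBlossomingMap k V D) (d : D) : M.inWeight d = k - M.weight d := by
  unfold inWeight
  by_cases h : M.opp d = d
  · by_cases ho : d ∈ M.opening
    · simp [h, ho, M.weight_opening d ho]
    · simp [h, ho, M.weight_closing d h ho]
  · have := M.weight_edge d h
    rw [if_neg h]
    omega

theorem indeg_congr (hv : M.vert = N.vert) (hw : M.weight = N.weight) (v : V) :
    M.indeg v = N.indeg v := by
  simp only [indeg, inWeight_eq, hv, hw]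

theorem outdeg_congr (hv : M.vert = N.vert) (hw : M.weight = N.weight) (v : V) :
    M.outdeg v = N.outdeg v := by
  simp only [outdeg, hv, hw]

/-- A local closure of oriented maps that merges the stems `b` and `c`. -/
def ClosesAt (M N : OrientedBlossomingMap k V D) (b c : D) : Prop :=
  M.toBlossomingMap.ClosesAt N.toBlossomingMap b c ∧ N.weight = M.weight

/-- A local closure of oriented maps. -/
def Step (M N : OrientedBlossomingMap k V D) : Prop := ∃ b c, M.ClosesAt N b c

theorem ClosesAt.weight_right (h : M.ClosesAt N b c) : N.weight c = 0 := by
  rw [h.2]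
  exact M.weight_closing c h.1.stem_right h.1.right_mem_closing.2

theorem exists_of_closesAt_left {N : BlossomingMap V D}
    (h : M.toBlossomingMap.ClosesAt N b c) :
    ∃ N' : OrientedBlossomingMap k V D, N'.toBlossomingMap = N ∧ M.ClosesAt N' b c := by
  have hb := M.weight_opening b h.left_mem_opening
  have hc := M.weight_closing c h.stem_right h.right_mem_closing.2
  refine ⟨{ N with
    weight := M.weight
    weight_edge := fun d hd => ?_
    weight_opening := fun d hd => ?_
    weight_closing := fun d hd hd' => ?_ }, rfl, h, rfl⟩
  · by_cases h1 : d = b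
    · subst h1; rw [h.opp_left, hb, hc, add_zero]
    by_cases h2 : d = c
    · subst h2; rw [h.opp_right, hb, hc, zero_add]
    rw [h.opp_of_ne d h1 h2] at hd ⊢
    exact M.weight_edge d hd
  · rw [h.opening_eq] at hd
    exact M.weight_opening d hd.1
  · have h1 : d ≠ b := by rintro rfl; exact h.ne (hd.symm.trans h.opp_left)
    refine M.weight_closing d ((h.stem_iff d).2 (Or.inl hd)) fun ho => hd' ?_
    rw [h.opening_eq]
    exact ⟨ho, h1⟩

/-- Weight zero at `c` forces weight `k` at `b`: exactly the weights required of a closing and an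
opening stem. -/
theorem exists_of_closesAt_right {M : BlossomingMap V D}
    (h : M.ClosesAt N.toBlossomingMap b c) (hc : N.weight c = 0) :
    ∃ M' : OrientedBlossomingMap k V D, M'.toBlossomingMap = M ∧ M'.ClosesAt N b c := by
  have hb : N.weight b = k := by
    have := N.weight_edge b (by rw [h.opp_left]; exact h.ne.symm)
    rwa [h.opp_left, hc, add_zero] at this
  refine ⟨{ M with
    weight := N.weight
    weight_edge := fun d hd => ?_
    weight_opening := fun d hd => ?_
    weight_closing := fun d hd hd' => ?_ }, rfl, h, rfl⟩
  · have h1 : d ≠ b := by rintro rfl; exact hd h.stem_left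
    have h2 : d ≠ c := by rintro rfl; exact hd h.stem_right
    rw [← h.opp_of_ne d h1 h2] at hd ⊢
    exact N.weight_edge d hd
  · rw [h.opening] at hd
    rcases hd with rfl | hd
    · exact hb
    · exact N.weight_opening d hd
  · rw [h.opening, Set.mem_insert_iff, not_or] at hd'
    by_cases h2 : d = c
    · subst h2; exact hc
    rw [← h.opp_of_ne d hd'.1 h2] at hd
    exact N.weight_closing d hd hd'.2

theorem exists_of_reflTransGen [Finite D] {N : BlossomingMap V D}
    (h : Relation.ReflTransGen LocalClosure M.toBlossomingMap N) :
    ∃ N' : OrientedBlossomingMap k V D, N'.toBlossomingMap = N ∧ N'.weight = M.weight ∧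
      Relation.ReflTransGen Step M N' := by
  induction h with
  | refl => exact ⟨M, rfl, rfl, .refl⟩
  | tail _ h ih =>
    obtain ⟨N', rfl, hw, hN'⟩ := ih
    obtain ⟨b, c, h⟩ := localClosure_iff.1 h
    obtain ⟨P, rfl, hP⟩ := exists_of_closesAt_left h
    exact ⟨P, rfl, hP.2.trans hw, hN'.tail ⟨b, c, hP⟩⟩

theorem reflTransGen_step_iff [Finite D] : Relation.ReflTransGen Step M N ↔
    Relation.ReflTransGen LocalClosure M.toBlossomingMap N.toBlossomingMap ∧
      N.weight = M.weight := by
  constructor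
  · intro h
    induction h with
    | refl => exact ⟨.refl, rfl⟩
    | tail _ h ih =>
      obtain ⟨b, c, h⟩ := h
      exact ⟨ih.1.tail h.1.localClosure, h.2.trans ih.2⟩
  · rintro ⟨h, hw⟩
    obtain ⟨N', h1, h2, h3⟩ := exists_of_reflTransGen h
    rwa [ext_of h1 (h2.trans hw.symm)] at h3

theorem ClosesAt.isAccessible (h : M.ClosesAt N b c) (hM : M.IsAccessible) : N.IsAccessible := by
  intro v
  rw [h.1.root]
  refine Relation.ReflTransGen.mono (fun x y => ?_) _ _ (hM v)
  rintro ⟨d, h1, h2, h3, h4⟩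
  have hb : d ≠ b := by rintro rfl; exact h1 h.1.stem_left
  have hc : d ≠ c := by rintro rfl; exact h1 h.1.stem_right
  refine ⟨d, ?_, ?_, ?_, ?_⟩
  · rwa [h.1.opp_of_ne d hb hc]
  · rwa [h.2]
  · rwa [h.1.vert]
  · rwa [h.1.opp_of_ne d hb hc, h.1.vert]

/-- A circuit of `M` uses no stem, so it is a circuit of `N` that avoids the edge `b`, `c`. Walking
past a stem in `M` amounts in `N` to crossing this edge, so sides are preserved. -/
theorem ClosesAt.isMinimal [Finite D] (h : M.ClosesAt N b c) (hN : N.IsMinimal) :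
    M.IsMinimal := by
  rintro n γ ⟨h1, h2, h3, h4⟩ ⟨i, x, hx, hs⟩
  have hb : ∀ i, γ i ≠ b := fun i hi => h4 i i (by rw [hi, h.1.stem_left])
  have hc : ∀ i, γ i ≠ c := fun i hi => h4 i i (by rw [hi, h.1.stem_right])
  have hopp : ∀ i, N.opp (γ i) = M.opp (γ i) := fun i => h.1.opp_of_ne _ (hb i) (hc i)
  have hbr : b ∉ Set.range γ := fun ⟨i, hi⟩ => hb i hi
  have hcr : c ∉ Set.range γ := fun ⟨i, hi⟩ => hc i hi
  have hsbc : N.SameSide γ b c := .single (Or.inr ⟨h.1.opp_left.symm, hbr, hcr⟩)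
  have hscb : N.SameSide γ c b := .single (Or.inr ⟨h.1.opp_right.symm, hcr, hbr⟩)
  have key : ∀ x y, M.SameSide γ x y → N.SameSide γ x y := by
    intro x y hxy
    induction hxy with
    | refl => exact .refl
    | tail _ hstep ih =>
      refine ih.trans ?_
      rename_i y z _
      by_cases h1 : y = b
      · rcases hstep with hz | ⟨hz, -⟩
        · rw [hz, h1, h.1.face_left]
          exact hsbc.tail (Or.inl rfl)
        · rw [hz, h1, h.1.stem_left]
      by_cases h2 : y = c
      · rcases hstep with hz | ⟨hz, -⟩
        · rw [hz, h2, h.1.face_right]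
          exact hscb.tail (Or.inl rfl)
        · rw [hz, h2, h.1.stem_right]
      refine .single ?_
      rwa [← h.1.face_of_ne h1 h2, h.1.opp_of_ne _ h1 h2]
  -- The witness `x` may be on the bounded face of `N`; it is moved along the outer face of `M` to
  -- `b`, which is outer in both.
  have hxb : M.face.SameCycle x b :=
    (BlossomingMap.mem_outer_iff hx b).1 (h.1.outer_subset h.1.left_mem)
  obtain ⟨m, -, -, hm⟩ := hxb.exists_pow_eq''
  have hsb : M.SameSide γ (M.opp (γ i)) b := by
    refine hs.trans ?_
    rw [← hm]
    clear hm
    induction m with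
    | zero => exact .refl
    | succ m ih => exact ih.tail (Or.inl (by rw [pow_succ', Perm.mul_apply]))
  refine hN n γ ⟨fun i => ?_, fun i => ?_, ?_, fun i j => ?_⟩ ⟨i, b, h.1.left_mem, ?_⟩
  · rw [h.2]; exact h1 i
  · rw [hopp, h.1.vert]; exact h2 i
  · rw [h.1.vert]; exact h3
  · rw [hopp]; exact h4 i j
  · rw [hopp]; exact key _ _ hsb

/-- If the outer face is not on the left of a fully directed edge, then its border contains a
counterclockwise cycle. -/
theorem exists_full_edge [Finite V] [Finite D] (hmin : M.IsMinimal) (htree : ¬ M.IsTree) :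
    ∃ d ∈ M.outer, M.opp d ∉ M.outer ∧ M.weight (M.opp d) = 0 := by
  by_contra! hno
  -- By assumption, every border edge can be followed with the outer face on its right.
  have hX : ∀ d, d ∉ M.outer → M.opp d ∈ M.outer → 0 < M.weight d := by
    intro d h1 h2
    have := hno _ h2 (by rwa [M.opp_opp])
    rw [M.opp_opp] at this
    exact Nat.pos_of_ne_zero this
  obtain ⟨d₀, hd₀, hd₀'⟩ : ∃ d ∈ M.outer, M.opp d ∉ M.outer := by
    by_contra! h
    exact htree (isTree_of_opp_mem_outer h)
  let S : Set V := {v | ∃ d, (d ∉ M.outer ∧ M.opp d ∈ M.outer) ∧ M.vert d = v}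
  -- Outside `S` the value `d₀` is a dummy.
  have hg : ∀ v, ∃ d, v ∈ S → (d ∉ M.outer ∧ M.opp d ∈ M.outer) ∧ M.vert d = v := by
    intro v
    by_cases hv : v ∈ S
    · obtain ⟨d, hd⟩ := hv
      exact ⟨d, fun _ => hd⟩
    · exact ⟨d₀, fun h => absurd h hv⟩
  choose g hg using hg
  let F : V → V := fun v => M.vert (M.opp (g v))
  have hF : ∀ v ∈ S, F v ∈ S := fun v hv =>
    exists_succ_of_border (hg v hv).1.1 (hg v hv).1.2
  have hFn : ∀ n, ∀ v ∈ S, F^[n] v ∈ S := by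
    intro n
    induction n with
    | zero => exact fun v hv => hv
    | succ n ih => exact fun v hv => ih _ (hF v hv)
  have hv₀ : M.vert (M.opp d₀) ∈ S := ⟨M.opp d₀, ⟨hd₀', by rwa [M.opp_opp]⟩, rfl⟩
  -- Finiteness gives a periodic vertex of the successor map `F`; a minimal period makes the cycle
  -- simple.
  obtain ⟨i, j, hij, heq⟩ := Finite.exists_ne_map_eq_of_infinite
    fun n : ℕ => F^[n] (M.vert (M.opp d₀))
  obtain ⟨v, hv, hper⟩ : ∃ v ∈ S, v ∈ Function.periodicPts F := by
    have key : ∀ i j : ℕ, i < j → F^[i] (M.vert (M.opp d₀)) = F^[j] (M.vert (M.opp d₀)) →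
        ∃ v ∈ S, v ∈ Function.periodicPts F := by
      intro i j hij h
      refine ⟨_, hFn i _ hv₀, Function.mk_mem_periodicPts (n := j - i) (by omega) ?_⟩
      rw [Function.IsPeriodicPt, Function.IsFixedPt, ← Function.iterate_add_apply,
        Nat.sub_add_cancel hij.le, h]
    rcases lt_or_gt_of_ne hij with h | h
    · exact key i j h heq
    · exact key j i h heq.symm
  have hpos := Function.minimalPeriod_pos_of_mem_periodicPts hper
  obtain ⟨m, hm⟩ : ∃ m, Function.minimalPeriod F v = m + 1 := ⟨_, (Nat.sub_add_cancel hpos).symm⟩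
  have hγ : ∀ i : Fin (m + 1), _ := fun i => hg (F^[i] v) (hFn i v hv)
  have hcirc : M.IsCircuit fun i : Fin (m + 1) => g (F^[i] v) := by
    refine ⟨fun i => hX _ (hγ i).1.1 (hγ i).1.2, fun i => ?_, fun i j hij => ?_, fun i j h => ?_⟩
    · have h1 : ((i + 1 : Fin (m + 1)) : ℕ) = ((i : ℕ) + 1) % Function.minimalPeriod F v := by
        rw [hm, Fin.val_add, Fin.val_one']
        simp
      rw [(hγ (i + 1)).2, h1, Function.iterate_mod_minimalPeriod_eq,
        Function.iterate_succ_apply']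
    · simp only [(hγ i).2, (hγ j).2] at hij
      refine Fin.ext (Function.iterate_injOn_Iio_minimalPeriod ?_ ?_ hij)
      · rw [hm]; exact i.2
      · rw [hm]; exact j.2
    · have h' : M.opp (g (F^[i] v)) = g (F^[j] v) := h
      exact (hγ j).1.1 (h' ▸ (hγ i).1.2)
  exact hmin m _ hcirc ⟨0, _, (hγ 0).1.2, .refl⟩

/-- One directed step that avoids the edge of `b`. -/
def StepAvoiding (M : OrientedBlossomingMap k V D) (b : D) (x y : V) : Prop :=
  ∃ d, M.opp d ≠ d ∧ d ≠ b ∧ d ≠ M.opp b ∧ 0 < M.weight d ∧ M.vert d = x ∧ M.vert (M.opp d) = y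

/-- The half `opp b` cannot be followed, so only traversals of `b` need a detour, and the detour
from `vert b` is given. -/
theorem reach_avoiding_of_left (hacc : M.IsAccessible) (hw : M.weight (M.opp b) = 0)
    (h : Relation.ReflTransGen (M.StepAvoiding b) (M.vert b) M.root) (v : V) :
    Relation.ReflTransGen (M.StepAvoiding b) v M.root := by
  induction hacc v using Relation.ReflTransGen.head_induction_on with
  | refl => exact .refl
  | head hs _ ih =>
    obtain ⟨d, h1, h2, rfl, rfl⟩ := hs
    by_cases hb : d = b
    · rwa [hb]
    · exact ih.head ⟨d, h1, hb, by rintro rfl; omega, h2, rfl, rfl⟩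

/-- On an oriented path to the root, what follows the last traversal of `b` starts at `vert (opp b)`
and avoids the edge. -/
theorem reach_avoiding_right (hacc : M.IsAccessible) (hw : M.weight (M.opp b) = 0) :
    Relation.ReflTransGen (M.StepAvoiding b) (M.vert (M.opp b)) M.root := by
  have key : ∀ v, Relation.ReflTransGen (M.StepAvoiding b) v M.root ∨
      Relation.ReflTransGen (M.StepAvoiding b) (M.vert (M.opp b)) M.root := by
    intro v
    induction hacc v using Relation.ReflTransGen.head_induction_on with
    | refl => exact .inl .refl
    | head hs _ ih =>
      rcases ih with ih | ih
      · obtain ⟨d, h1, h2, rfl, rfl⟩ := hs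
        by_cases hb : d = b
        · subst hb; exact .inr ih
        · exact .inl (ih.head ⟨d, h1, hb, by rintro rfl; omega, h2, rfl, rfl⟩)
      · exact .inr ih
  exact (key _).elim id id

/-- Some fully directed edge with the outer face exactly on its left can be removed without
destroying accessibility. -/
theorem exists_removable_edge [Finite V] [Finite D] (hmin : M.IsMinimal) (hacc : M.IsAccessible)
    (htree : ¬ M.IsTree) : ∃ b ∈ M.outer, M.opp b ∉ M.outer ∧ M.weight (M.opp b) = 0 ∧
      Relation.ReflTransGen (M.StepAvoiding b) (M.vert b) M.root := by
  obtain ⟨b, hb, hc, hw⟩ := exists_full_edge hmin htree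
  by_cases hreach : Relation.ReflTransGen (M.StepAvoiding b) (M.vert b) M.root
  · exact ⟨b, hb, hc, hw, hreach⟩
  let A : Set V := {v | ¬ Relation.ReflTransGen (M.StepAvoiding b) v M.root}
  have hcA : M.vert (M.opp b) ∉ A := not_not.2 (reach_avoiding_right hacc hw)
  have hcross : ∀ d, M.vert d ∈ A → M.vert (M.opp d) ∉ A → d ≠ b → M.weight d = 0 := by
    intro d h1 h2 h3
    by_contra h4
    refine h1 (Relation.ReflTransGen.head ⟨d, fun h => h2 (by rwa [h]), h3, ?_,
      Nat.pos_of_ne_zero h4, rfl, rfl⟩ (not_not.1 h2))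
    rintro rfl
    exact h4 hw
  -- The contour after `b` starts outside `A` and comes back to `vert b` in `A`; `z` is where it
  -- enters `A`.
  have hcyc : M.face.SameCycle (M.face b) b := SameCycle.symm ⟨1, by simp⟩
  obtain ⟨z, hz, hz1, hz2⟩ := hcyc.exists_exit (S := {d | M.vert d ∉ A})
    (by rw [Set.mem_ofPred_eq, vert_face]; exact hcA) (fun h => h hreach)
  rw [Set.mem_ofPred_eq, vert_face, not_not] at hz2
  change M.vert z ∉ A at hz1
  have hzo : z ∈ M.outer := (mem_outer_congr hz).1 ((M.face_mem_outer b).2 hb)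
  have hzc : M.opp z ≠ b := by
    intro h
    rw [← h, M.opp_opp] at hc
    exact hc hzo
  have hzw : M.weight (M.opp z) = 0 := hcross _ hz2 (by rwa [M.opp_opp]) hzc
  -- A path from outside `A` that avoids `b` stays outside `A`, so it cannot use `z`, which has an
  -- end in `A`.
  have hzr : Relation.ReflTransGen (M.StepAvoiding z) (M.vert z) M.root := by
    have hz1' : Relation.ReflTransGen (M.StepAvoiding b) (M.vert z) M.root := not_not.1 hz1
    generalize M.vert z = v at hz1'
    induction hz1' using Relation.ReflTransGen.head_induction_on with
    | refl => exact .refl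
    | head hs hr ih =>
      have hx := Relation.ReflTransGen.head hs hr
      obtain ⟨d, h1, h2, h3, h4, rfl, rfl⟩ := hs
      refine ih.head ⟨d, h1, ?_, ?_, h4, rfl, rfl⟩
      · rintro rfl
        exact hz2 hr
      · rintro rfl
        exact hz2 hx
  refine ⟨z, hzo, fun hzo' => ?_, hzw, hzr⟩
  have hne : M.opp z ≠ z := fun h => hz1 (by rwa [h] at hz2)
  -- With the outer face on both sides `z` would be a bridge, but both its ends reach the root
  -- without it.
  obtain ⟨B, hB1, hB2, hB⟩ := M.exists_separation hne ((BlossomingMap.mem_outer_iff hzo _).1 hzo')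
  have key : ∀ v, Relation.ReflTransGen (M.StepAvoiding z) v M.root → (v ∈ B ↔ M.root ∈ B) := by
    intro v hv
    induction hv using Relation.ReflTransGen.head_induction_on with
    | refl => rfl
    | head hs _ ih =>
      obtain ⟨d, -, h2, h3, -, rfl, rfl⟩ := hs
      rw [hB d h2 h3, ih]
  exact hB2 ((key _ (reach_avoiding_right hacc hzw)).2 ((key _ hzr).1 hB1))

theorem exists_closesAt_of_removable [Finite D] (hacc : M.IsAccessible) (hb : b ∈ M.outer)
    (hc : M.opp b ∉ M.outer) (hw : M.weight (M.opp b) = 0)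
    (hr : Relation.ReflTransGen (M.StepAvoiding b) (M.vert b) M.root) :
    ∃ N : OrientedBlossomingMap k V D, N.ClosesAt M b (M.opp b) ∧ N.IsAccessible := by
  have hreach := reach_avoiding_of_left hacc hw hr
  let R : V → V → Prop := fun x y =>
    ∃ d, d ≠ b ∧ d ≠ M.opp b ∧ M.vert d = x ∧ M.vert (M.opp d) = y
  have hR : ∀ v, Relation.ReflTransGen R v M.root := fun v =>
    Relation.ReflTransGen.mono (fun x y ⟨d, _, h2, h3, _, h5, h6⟩ => ⟨d, h2, h3, h5, h6⟩) _ _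
      (hreach v)
  have hsymm : ∀ x y, Function.swap R x y → R x y := by
    rintro x y ⟨d, h1, h2, rfl, rfl⟩
    refine ⟨M.opp d, fun h => h2 ?_, fun h => h1 (M.opp.injective h), rfl, by rw [M.opp_opp]⟩
    rw [← h, M.opp_opp]
  obtain ⟨P, hP⟩ := exists_closesAt_of_connected hb hc fun v w =>
    (hR v).trans (Relation.ReflTransGen.mono hsymm _ _ (hR w).swap)
  obtain ⟨N, -, hN⟩ := exists_of_closesAt_right hP hw
  refine ⟨N, hN, fun v => ?_⟩
  rw [← hN.1.root]
  refine Relation.ReflTransGen.mono ?_ _ _ (hreach v)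
  rintro x y ⟨d, h1, h2, h3, h4, h5, h6⟩
  refine ⟨d, ?_, ?_, ?_, ?_⟩
  · rwa [← hN.1.opp_of_ne d h2 h3]
  · rwa [← hN.2]
  · rwa [← hN.1.vert]
  · rwa [← hN.1.opp_of_ne d h2 h3, ← hN.1.vert]

/-- Each cut turns one more half-edge into an opening stem, so the number of other half-edges
decreases. -/
theorem exists_tree [Finite V] [Finite D] (hmin : M.IsMinimal) (hacc : M.IsAccessible) :
    ∃ T : OrientedBlossomingMap k V D, T.IsAccessibleTree ∧ Relation.ReflTransGen Step T M := by
  suffices ∀ (n : ℕ) (M : OrientedBlossomingMap k V D), (M.openingᶜ).ncard = n → M.IsMinimal →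
      M.IsAccessible → ∃ T : OrientedBlossomingMap k V D, T.IsAccessibleTree ∧
        Relation.ReflTransGen Step T M from this _ M rfl hmin hacc
  intro n
  induction n using Nat.strong_induction_on with
  | _ n ih =>
  intro M hn hmin hacc
  by_cases htree : M.IsTree
  · exact ⟨M, ⟨htree, hacc⟩, .refl⟩
  obtain ⟨b, hb, hc, hw, hr⟩ := exists_removable_edge hmin hacc htree
  obtain ⟨N, hN, hNacc⟩ := exists_closesAt_of_removable hacc hb hc hw hr
  have hlt : (N.openingᶜ).ncard < n := by
    rw [← hn, hN.1.opening]
    refine Set.ncard_lt_ncard ⟨Set.compl_subset_compl.2 (Set.subset_insert _ _), fun h => ?_⟩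
    exact h hN.1.left_notMem_opening (Set.mem_insert _ _)
  obtain ⟨T, hT, hTN⟩ := ih _ hlt N rfl (hN.isMinimal hmin) hNacc
  exact ⟨T, hT, hTN.tail ⟨_, _, hN⟩⟩

end OrientedBlossomingMap

/-! ### Circulations and face potentials: a discrete Jordan theorem -/

namespace BlossomingMap

open Equiv Equiv.Perm

variable {V D : Type u} {M N : BlossomingMap V D} {b c : D}

/-- An integer flow along the edges without sources and sinks; conservation at the vertices is
tested against functions on the vertices. -/
def IsCirculation [Fintype D] (M : BlossomingMap V D) (γ : D → ℤ) : Prop :=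
  (∀ d, γ (M.opp d) = -γ d) ∧ ∀ p : V → ℤ, ∑ d, p (M.vert d) * γ d = 0

/-- Every circulation is the coboundary of a function on the faces. -/
def HasPotentials [Fintype D] (M : BlossomingMap V D) : Prop :=
  ∀ γ, M.IsCirculation γ → ∃ h : D → ℤ, (∀ d, h (M.face d) = h d) ∧
    ∀ d, h d - h (M.opp d) = γ d

theorem eq_of_sameCycle {σ : Perm D} {h : D → ℤ} (hσ : ∀ d, h (σ d) = h d) {x y : D}
    (hxy : σ.SameCycle x y) : h x = h y :=
  sameCycle_of_apply (r := Setoid.ker h) (fun d => (hσ d).symm) hxy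

/-- In a tree every edge is a bridge. Testing conservation against the indicator of one side shows
that the flow through it is zero. -/
theorem IsTree.hasPotentials [Fintype D] (h : M.IsTree) : M.HasPotentials := by
  classical
  intro γ ⟨hγ, hdiv⟩
  refine ⟨fun _ => 0, fun _ => rfl, fun b => ?_⟩
  change (0 : ℤ) - 0 = γ b
  rw [sub_zero]
  by_cases hb : M.opp b = b
  · have := hγ b
    rw [hb] at this
    omega
  obtain ⟨A, hA1, hA2, hA⟩ := M.exists_separation hb (h.sameCycle _ _)
  let p : V → ℤ := fun v => if v ∈ A then 1 else 0
  have h1 : ∑ d, p (M.vert (M.opp d)) * γ d = 0 := by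
    rw [← Equiv.sum_comp M.opp]
    have := hdiv p
    rw [← neg_eq_zero, ← Finset.sum_neg_distrib] at this
    rw [← this]
    refine Finset.sum_congr rfl fun d _ => ?_
    rw [M.opp_opp, hγ, mul_neg]
  have h2 : ∑ d, (p (M.vert d) - p (M.vert (M.opp d))) * γ d = 0 := by
    simp only [sub_mul, Finset.sum_sub_distrib, hdiv p, h1, sub_zero]
  rw [Finset.sum_eq_add b (M.opp b) (Ne.symm hb)] at h2
  · rw [M.opp_opp, hγ] at h2
    simp only [p, hA1, hA2, if_true, if_false] at h2
    omega
  · intro d _ hd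
    have : p (M.vert d) = p (M.vert (M.opp d)) := by
      simp only [p, hA d hd.1 hd.2]
    rw [this, sub_self, zero_mul]
  · exact fun h => absurd (Finset.mem_univ _) h
  · exact fun h => absurd (Finset.mem_univ _) h

/-- Adding `γ b` times the coboundary of the indicator `ι` of the new face cancels the flow through
the closure edge. What remains is a circulation of `M`; its potential is corrected by `γ b * ι`. -/
theorem ClosesAt.hasPotentials [Fintype D] (h : ClosesAt M N b c) (hM : M.HasPotentials) :
    N.HasPotentials := by
  classical
  intro γ ⟨hγ, hdiv⟩
  let ι : D → ℤ := fun d => if N.face.SameCycle c d then 1 else 0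
  have hιf : ∀ d, ι (N.face d) = ι d := fun d => by
    simp only [ι, sameCycle_apply_right]
  have hιc : ι c = 1 := if_pos (SameCycle.refl _ _)
  have hιb : ι b = 0 := by
    simp only [ι]
    rw [if_neg fun h' => h.not_sameCycle h'.symm]
  have hιo : ∀ d, ι (N.opp d) = ι (N.rot d) := fun d => by
    rw [← face_opp, hιf]
  let γ' : D → ℤ := fun d => γ d + γ b * (ι d - ι (N.opp d))
  have hγb : γ' b = 0 := by
    simp only [γ', h.opp_left, hιb, hιc]; ring
  have hγc : γ' c = 0 := by
    have := hγ b
    rw [h.opp_left] at this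
    simp only [γ', h.opp_right, hιb, hιc, this]; ring
  have hcirc : M.IsCirculation γ' := by
    refine ⟨fun d => ?_, fun p => ?_⟩
    · by_cases h1 : d = b
      · rw [h1, h.stem_left, hγb, neg_zero]
      by_cases h2 : d = c
      · rw [h2, h.stem_right, hγc, neg_zero]
      rw [← h.opp_of_ne d h1 h2]
      simp only [γ', hγ, N.opp_opp]
      ring
    -- Around each vertex, the differences between `ι d` and `ι (rot d)` cancel.
    · have h1 : ∑ d, p (N.vert d) * ι (N.rot d) = ∑ d, p (N.vert d) * ι d := by
        rw [← Equiv.sum_comp N.rot fun d => p (N.vert d) * ι d]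
        simp only [vert_rot]
      rw [← h.vert]
      calc ∑ d, p (N.vert d) * γ' d = ∑ d, p (N.vert d) * γ d +
          γ b * (∑ d, p (N.vert d) * ι d - ∑ d, p (N.vert d) * ι (N.rot d)) := by
            rw [← Finset.sum_sub_distrib, Finset.mul_sum, ← Finset.sum_add_distrib]
            refine Finset.sum_congr rfl fun d _ => ?_
            simp only [γ', hιo]
            ring
        _ = 0 := by rw [hdiv, h1]; ring
  obtain ⟨g, hg, hgγ⟩ := hM γ' hcirc
  have hgo : ∀ d ∈ M.outer, g d = g b := fun d hd =>
    eq_of_sameCycle hg ((BlossomingMap.mem_outer_iff hd b).1 (M.stem_outer b h.stem_left))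
  have hgc : g c = g b := hgo c (M.stem_outer c h.stem_right)
  have hgf : ∀ d, g (N.face d) = g d := by
    intro d
    by_cases h1 : d = b
    · rw [h1, ← h.face_right, hg, hgc]
    by_cases h2 : d = c
    · rw [h2, ← h.face_left, hg, hgc]
    rw [← h.face_of_ne h1 h2, hg]
  refine ⟨fun d => g d - γ b * ι d, fun d => ?_, fun d => ?_⟩
  · simp only [hgf, hιf]
  · have key : g d - g (N.opp d) = γ' d := by
      by_cases h1 : d = b
      · rw [h1, h.opp_left, hgc, hγb, sub_self]
      by_cases h2 : d = c
      · rw [h2, h.opp_right, hgc, hγc, sub_self]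
      rw [h.opp_of_ne d h1 h2, hgγ]
    simp only [γ'] at key
    linear_combination key

end BlossomingMap

/-! ### The closure of an accessible tree is minimal and accessible -/

namespace OrientedBlossomingMap

open Equiv Equiv.Perm BlossomingMap

variable {k : ℕ} {V D : Type u} {M N : OrientedBlossomingMap k V D} {b c : D}

/-- A move along a face, or across an edge from the side that no unit has on its left. -/
def Descent (M : OrientedBlossomingMap k V D) (x y : D) : Prop :=
  y = M.face x ∨ (y = M.opp x ∧ M.weight x = 0)

/-- The outer face can be reached from everywhere by descents. -/
def DescendsToOuter (M : OrientedBlossomingMap k V D) : Prop :=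
  ∀ x, ∃ y ∈ M.outer, Relation.ReflTransGen M.Descent x y

theorem reflTransGen_descent_of_sameCycle [Finite D] {x y : D} (h : M.face.SameCycle x y) :
    Relation.ReflTransGen M.Descent x y := by
  obtain ⟨n, -, -, rfl⟩ := h.exists_pow_eq''
  induction n with
  | zero => exact .refl
  | succ n ih => exact (ih ⟨n, by rw [zpow_natCast]⟩).tail (Or.inl (by rw [pow_succ', Perm.mul_apply]))

/-- Only the new face leaves the outer face, and one crossing from `c`, of weight zero, to `b` leads
back to it. -/
theorem ClosesAt.descendsToOuter [Finite D] (h : M.ClosesAt N b c) (hM : M.DescendsToOuter) :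
    N.DescendsToOuter := by
  intro x
  obtain ⟨y, hy, hxy⟩ := hM x
  have key : ∀ x ∈ M.outer, ∃ y ∈ N.outer, Relation.ReflTransGen N.Descent x y := by
    intro x hx
    rcases (h.1.mem_outer_iff x).1 hx with hx | hx
    · exact ⟨x, hx, .refl⟩
    · exact ⟨b, h.1.left_mem, (reflTransGen_descent_of_sameCycle hx.symm).tail
        (Or.inr ⟨h.1.opp_right.symm, h.weight_right⟩)⟩
  induction hxy using Relation.ReflTransGen.head_induction_on with
  | refl => exact key y hy
  | @head x z hs _ ih =>
    by_cases hx : x ∈ M.outer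
    · exact key x hx
    -- Before it meets the outer face of `M`, a descent meets no stem, so its steps are also
    -- descents of `N`.
    have hb : x ≠ b := by rintro rfl; exact hx (M.stem_outer _ h.1.stem_left)
    have hc : x ≠ c := by rintro rfl; exact hx (M.stem_outer _ h.1.stem_right)
    obtain ⟨w, hw, hzw⟩ := ih
    refine ⟨w, hw, hzw.head ?_⟩
    rcases hs with rfl | ⟨rfl, h0⟩
    · exact Or.inl (h.1.face_of_ne hb hc)
    · exact Or.inr ⟨(h.1.opp_of_ne x hb hc).symm, by rw [h.2, h0]⟩

theorem isMinimal_of_hasPotentials [Fintype D] (hJ : M.HasPotentials) (hQ : M.DescendsToOuter) :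
    M.IsMinimal := by
  classical
  rintro n γ ⟨h1, h2, h3, h4⟩ ⟨i, x, hx, hs⟩
  have hinj : Function.Injective γ := fun i j hij => h3 (congrArg M.vert hij)
  -- The unit flow along the cycle; its potential `h` is one higher on the left of the cycle than on
  -- the right.
  let f : D → ℤ := fun d => ∑ i, ((if γ i = d then 1 else 0) - if γ i = M.opp d then 1 else 0)
  have hcirc : M.IsCirculation f := by
    refine ⟨fun d => ?_, fun p => ?_⟩
    · simp only [f, M.opp_opp, ← Finset.sum_neg_distrib, neg_sub]
    · have e : ∀ d, p (M.vert d) * f d = ∑ i, ((if γ i = d then p (M.vert d) else 0) -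
          if M.opp (γ i) = d then p (M.vert d) else 0) := by
        intro d
        rw [Finset.mul_sum]
        refine Finset.sum_congr rfl fun i _ => ?_
        have : γ i = M.opp d ↔ M.opp (γ i) = d :=
          ⟨fun h => by rw [h, M.opp_opp], fun h => by rw [← h, M.opp_opp]⟩
        simp only [this, mul_sub, mul_ite, mul_one, mul_zero]
      simp only [e]
      rw [Finset.sum_comm]
      simp only [Finset.sum_sub_distrib, Finset.sum_ite_eq, Finset.mem_univ, if_true, h2]
      rw [sub_eq_zero]
      exact (Equiv.sum_comp (Equiv.addRight (1 : Fin (n + 1)))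
        fun i => p (M.vert (γ i))).symm
  obtain ⟨h, hf, hγ⟩ := hJ f hcirc
  have hfr : ∀ j, f (γ j) = 1 := by
    intro j
    have : ∀ i, γ i ≠ M.opp (γ j) := fun i => (h4 j i).symm
    simp only [f, this, hinj.eq_iff, if_false, sub_zero, Finset.sum_ite_eq', Finset.mem_univ,
      if_true]
  have hf0 : ∀ d, d ∉ Set.range γ → f d ≤ 0 := by
    intro d hd
    refine Finset.sum_nonpos fun i _ => ?_
    rw [if_neg fun h => hd ⟨i, h⟩]
    split_ifs <;> simp
  have hside : h (M.opp (γ i)) = h x := by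
    clear hx
    unfold SameSide at hs
    induction hs with
    | refl => rfl
    | @tail y z _ hstep ih =>
      rcases hstep with rfl | ⟨rfl, hy, hy'⟩
      · rw [hf, ih]
      · have h0 : f y = 0 := Finset.sum_eq_zero fun i _ => by
          rw [if_neg fun h => hy ⟨i, h⟩, if_neg fun h => hy' ⟨i, h⟩, sub_zero]
        have := hγ y
        omega
  obtain ⟨y, hy, hiy⟩ := hQ (γ i)
  have hle : h (γ i) ≤ h y := by
    clear hy
    induction hiy with
    | refl => exact le_rfl
    | @tail y z _ hstep ih =>
      refine ih.trans ?_
      rcases hstep with rfl | ⟨rfl, h0⟩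
      · rw [hf]
      -- A half-edge of weight zero is not on the cycle, so crossing it does not lower `h`.
      · have := hf0 y (by rintro ⟨j, rfl⟩; have := h1 j; omega)
        have := hγ y
        omega
  have hxy : h x = h y := eq_of_sameCycle hf ((BlossomingMap.mem_outer_iff hx y).1 hy)
  have := hγ (γ i)
  rw [hfr] at this
  omega

theorem isMinimal_of_reflTransGen [Finite D] (hT : M.IsTree)
    (h : Relation.ReflTransGen Step M N) : N.IsMinimal := by
  have := Fintype.ofFinite D
  have key : N.HasPotentials ∧ N.DescendsToOuter := by
    induction h with
    | refl => exact ⟨hT.hasPotentials, fun x => ⟨x, hT.mem_outer x, .refl⟩⟩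
    | tail _ h ih =>
      obtain ⟨b, c, h⟩ := h
      exact ⟨h.1.hasPotentials ih.1, h.descendsToOuter ih.2⟩
  exact isMinimal_of_hasPotentials key.1 key.2

theorem isAccessible_of_reflTransGen (hM : M.IsAccessible)
    (h : Relation.ReflTransGen Step M N) : N.IsAccessible := by
  induction h with
  | refl => exact hM
  | tail _ h ih =>
    obtain ⟨b, c, h⟩ := h
    exact h.isAccessible ih

end OrientedBlossomingMap

/-! ### Reordering local closures -/

namespace BlossomingMap

open Equiv Equiv.Perm

variable {V D : Type u} {T M N : BlossomingMap V D} {b c : D}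

theorem opp_eq_or_of_reflTransGen [Finite D] (h : Relation.ReflTransGen LocalClosure T M) (d : D) :
    T.opp d = M.opp d ∨ T.opp d = d := by
  induction h with
  | refl => exact Or.inl rfl
  | tail _ h ih =>
    obtain ⟨b, c, h⟩ := localClosure_iff.1 h
    by_cases hb : d = b
    · subst hb
      exact Or.inr (ih.elim (fun h' => h'.trans h.stem_left) id)
    by_cases hc : d = c
    · subst hc
      exact Or.inr (ih.elim (fun h' => h'.trans h.stem_right) id)
    rwa [h.opp_of_ne d hb hc]

theorem vert_eq_of_reflTransGen (h : Relation.ReflTransGen LocalClosure T M) : M.vert = T.vert := by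
  induction h with
  | refl => rfl
  | tail _ h ih =>
    obtain ⟨_, _, -, -, h, -⟩ := h
    exact h.trans ih

theorem root_eq_of_reflTransGen (h : Relation.ReflTransGen LocalClosure T M) : M.root = T.root := by
  induction h with
  | refl => rfl
  | tail _ h ih =>
    obtain ⟨_, _, -, -, -, h, -⟩ := h
    exact h.trans ih

/-- A closure edge does not have the outer face on both sides. -/
theorem notMem_outer_of_reflTransGen [Finite D] (h : Relation.ReflTransGen LocalClosure T M) {d : D}
    (hT : T.opp d = d) (hM : M.opp d ≠ d) : d ∉ M.outer ∨ M.opp d ∉ M.outer := by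
  induction h with
  | refl => exact absurd hT hM
  | tail _ h ih =>
    obtain ⟨b, c, h⟩ := localClosure_iff.1 h
    by_cases hb : d = b
    · subst hb
      exact Or.inr (h.opp_left ▸ h.right_notMem)
    by_cases hc : d = c
    · subst hc
      exact Or.inl h.right_notMem
    rw [h.opp_of_ne d hb hc] at hM ⊢
    exact (ih hM).imp (fun h' h'' => h' (h.outer_subset h'')) fun h' h'' => h' (h.outer_subset h'')

/-- A closure edge that borders the outer face can be taken to be the last one. -/
theorem exists_closesAt_of_reflTransGen [Finite D] (h : Relation.ReflTransGen LocalClosure T M)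
    (hT : T.opp b = b) (hM : M.opp b ≠ b) (hb : b ∈ M.outer) :
    ∃ N, ClosesAt N M b (M.opp b) ∧ Relation.ReflTransGen LocalClosure T N := by
  induction h with
  | refl => exact absurd hT hM
  | @tail P M hTP hPM ih =>
    have hTM := hTP.tail hPM
    have hc : M.opp b ∉ M.outer :=
      (notMem_outer_of_reflTransGen hTM hT hM).resolve_left (not_not.2 hb)
    have hTc : T.opp (M.opp b) = M.opp b := by
      refine (opp_eq_or_of_reflTransGen hTM (M.opp b)).resolve_left fun h' => hM ?_
      rw [M.opp_opp] at h'
      have h'' := congrArg T.opp h'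
      rwa [T.opp_opp, hT] at h''
    -- Cutting a closure edge keeps all edges of `T`, and these already connect the vertices.
    obtain ⟨N, hN⟩ := exists_closesAt_of_connected hb hc (fun v w => by
      induction T.connected v w with
      | refl => exact .refl
      | tail _ h ih =>
        refine ih.trans ?_
        obtain ⟨d, rfl, rfl⟩ := h
        by_cases hd : T.opp d = d
        · rw [hd]
        refine .single ⟨d, ?_, ?_, ?_, ?_⟩
        · rintro rfl; exact hd hT
        · rintro rfl; exact hd hTc
        · rw [vert_eq_of_reflTransGen hTM]
        · rw [vert_eq_of_reflTransGen hTM,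
            (opp_eq_or_of_reflTransGen hTM d).resolve_right hd])
    refine ⟨N, hN, ?_⟩
    obtain ⟨b', c', h⟩ := localClosure_iff.1 hPM
    have hbc' : b ≠ c' := by rintro rfl; exact h.right_notMem hb
    by_cases hbb : b = b'
    · subst hbb
      rw [h.opp_left] at hN
      rwa [hN.eq_of_right h]
    have hcb' : M.opp b ≠ b' := fun h' => hbc' (by rw [← h.opp_left, ← h', M.opp_opp])
    have hcc' : M.opp b ≠ c' := fun h' => hbb (by rw [← h.opp_right, ← h', M.opp_opp])
    have hopp : M.opp b = P.opp b := h.opp_of_ne b hbb hbc'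
    -- If the last local closure is another one, the edge `b` is already closed in `P`. It is cut
    -- there, giving `Q`, and closing `b'`, `c'` in `Q` gives `N`.
    obtain ⟨Q, hQ, hTQ⟩ := ih (hopp ▸ hM) (h.outer_subset hb)
    have hcP : P.opp b ∉ P.outer :=
      (notMem_outer_of_reflTransGen hTP hT (hopp ▸ hM)).resolve_left
        (not_not.2 (h.outer_subset hb))
    rw [← hopp] at hQ hcP
    refine hTQ.tail (ClosesAt.localClosure (b := b') (c := c') ?_)
    exact
      { rot := by rw [← hN.rot, h.rot, hQ.rot]
        vert := by rw [← hN.vert, h.vert, hQ.vert]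
        root := by rw [← hN.root, h.root, hQ.root]
        opp_left := by rw [← hN.opp_of_ne _ (Ne.symm hbb) hcb'.symm, h.opp_left]
        opp_right := by rw [← hN.opp_of_ne _ hbc'.symm hcc'.symm, h.opp_right]
        opp_of_ne := fun d h1 h2 => by
          by_cases h3 : d = b
          · rw [h3, hN.stem_left, hQ.stem_left]
          by_cases h4 : d = M.opp b
          · rw [h4, hN.stem_right, hQ.stem_right]
          rw [← hN.opp_of_ne d h3 h4, h.opp_of_ne d h1 h2, hQ.opp_of_ne d h3 h4]
        stem_left := by rw [← hQ.opp_of_ne _ (Ne.symm hbb) hcb'.symm, h.stem_left]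
        stem_right := by rw [← hQ.opp_of_ne _ hbc'.symm hcc'.symm, h.stem_right]
        ne := h.ne
        opening := by rw [hQ.opening, h.opening, hN.opening, Set.insert_comm]
        left_mem := hN.outer_subset h.left_mem
        right_notMem := fun hc' => by
          rcases (hN.mem_outer_iff c').1 hc' with h' | h'
          · exact h.right_notMem h'
          -- Were `c'` on the face merged back by the cut, `M.opp b` would share the face of `c'` in
          -- `M` and so be on the outer face of `P`.
          · exact hcP ((h.mem_outer_iff _).2 (Or.inr h'.symm)) }

theorem IsTree.eq_of_reflTransGen [Finite D] (hM : M.IsTree)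
    (h : Relation.ReflTransGen LocalClosure T M) : T = M := by
  rcases h.cases_tail with h | ⟨P, -, h⟩
  · exact h.symm
  · obtain ⟨b, c, h⟩ := localClosure_iff.1 h
    exact absurd (hM.sameCycle b c) h.not_sameCycle

end BlossomingMap

/-! ### Uniqueness of the tree -/

namespace OrientedBlossomingMap

open Equiv Equiv.Perm BlossomingMap

variable {k : ℕ} {V D : Type u} {T T' M : OrientedBlossomingMap k V D} {b : D}

/-- In the closure of an accessible tree, the edges that can be removed from the border of the outer
face are closure edges. -/
theorem opp_ne_of_removable [Finite D] (hT : T.IsAccessibleTree)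
    (h : Relation.ReflTransGen Step T M) (hb : b ∈ M.outer) (hc : M.opp b ∉ M.outer)
    (hw : M.weight (M.opp b) = 0)
    (hr : Relation.ReflTransGen (M.StepAvoiding b) (M.vert b) M.root) : T.opp b ≠ M.opp b := by
  intro hbc
  obtain ⟨hTM, hwM⟩ := reflTransGen_step_iff.1 h
  have hne : T.opp b ≠ b := by rw [hbc]; exact fun h' => hc (by rwa [h'])
  obtain ⟨A, hA1, hA2, hA⟩ := T.exists_separation hne (hT.1.sameCycle _ _)
  rw [hwM] at hw
  rw [← hbc] at hw
  -- The tree edge is fully directed out of `A`, so a root in `A` could not be reached from the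
  -- other side.
  have hroot : T.root ∉ A := by
    intro hroot
    have key : ∀ v, v ∈ A := by
      intro v
      induction hT.2 v using Relation.ReflTransGen.head_induction_on with
      | refl => exact hroot
      | head hs _ ih =>
        obtain ⟨d, h1, h2, rfl, rfl⟩ := hs
        by_cases h3 : d = b
        · rwa [h3]
        by_cases h4 : d = T.opp b
        · rw [h4] at h2; omega
        exact (hA d h3 h4).2 ih
    exact hA2 (key _)
  -- Invariant of the closure while `b` borders the outer face: any other half-edge leading out of
  -- `A` has weight zero and is off the outer face. The second part is what carries the induction.
  have hinv : ∀ P : BlossomingMap V D, Relation.ReflTransGen LocalClosure T.toBlossomingMap P →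
      b ∈ P.outer → ∀ d, d ≠ b → T.vert d ∈ A → T.vert (P.opp d) ∉ A →
        d ∉ P.outer ∧ T.weight d = 0 := by
    intro P hP
    induction hP with
    | refl =>
      intro _ d hd h1 h2
      refine absurd ((hA d hd ?_).1 h1) h2
      rintro rfl
      exact hA2 h1
    | @tail P Q hTP hPQ ih =>
      intro hbQ d hd h1 h2
      obtain ⟨b', c', h⟩ := localClosure_iff.1 hPQ
      have ih := ih (h.outer_subset hbQ)
      by_cases hc' : d = c'
      · subst hc'
        refine ⟨h.right_notMem, ?_⟩
        obtain ⟨P', rfl, hP', -⟩ := exists_of_reflTransGen hTP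
        rw [← hP']
        exact P'.weight_closing d h.stem_right h.right_mem_closing.2
      by_cases hb' : d = b'
      · exfalso
        subst hb'
        rw [h.opp_left] at h2
        have hv : Q.vert = T.vert := vert_eq_of_reflTransGen (hTP.tail hPQ)
        -- A closure edge directed out of `A` would enclose a face whose border starts in `A` and
        -- ends outside. It leaves `A` along some `z` other than `b`, which was on the outer face of
        -- `P`, against the invariant.
        have hcyc : Q.face.SameCycle (Q.face c') c' := SameCycle.symm ⟨1, by simp⟩
        obtain ⟨z, hz, hz1, hz2⟩ := hcyc.exists_exit (S := {d | T.vert d ∈ A})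
          (by rw [Set.mem_ofPred_eq, ← hv, vert_face, h.opp_right, hv]; exact h1) h2
        change T.vert z ∈ A at hz1
        rw [Set.mem_ofPred_eq, ← hv, vert_face, hv] at hz2
        have hz' : Q.face.SameCycle c' z := SameCycle.trans ⟨1, by simp⟩ hz
        have hzQ : z ∉ Q.outer := fun h' => h.right_notMem ((mem_outer_congr hz').2 h')
        have hzb' : z ≠ d := by rintro rfl; exact hzQ h.left_mem
        have hzc' : z ≠ c' := by rintro rfl; exact h2 hz1
        have hzb : z ≠ b := by rintro rfl; exact hzQ hbQ
        rw [h.opp_of_ne z hzb' hzc'] at hz2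
        exact (ih z hzb hz1 hz2).1 ((h.mem_outer_iff z).2 (Or.inr hz'))
      rw [h.opp_of_ne d hb' hc'] at h2
      exact ⟨fun h' => (ih d hd h1 h2).1 (h.outer_subset h'), (ih d hd h1 h2).2⟩
  have hv : M.vert = T.vert := vert_eq_of_reflTransGen hTM
  have key : ∀ v, Relation.ReflTransGen (M.StepAvoiding b) v M.root → v ∉ A := by
    intro v hv'
    induction hv' using Relation.ReflTransGen.head_induction_on with
    | refl => rwa [root_eq_of_reflTransGen hTM]
    | head hs _ ih =>
      obtain ⟨d, h1, h2, h3, h4, rfl, rfl⟩ := hs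
      intro h5
      rw [hv] at h5 ih
      have := (hinv _ hTM hb d h2 h5 ih).2
      rw [hwM] at h4
      omega
  exact key _ hr (hv ▸ hA1)

/-- A removable edge depends on `M` only and is a closure edge for both trees; cutting it gives a
smaller common closure `N`. -/
theorem eq_of_reflTransGen [Finite V] [Finite D] (hT : T.IsAccessibleTree)
    (hT' : T'.IsAccessibleTree) (h : Relation.ReflTransGen Step T M)
    (h' : Relation.ReflTransGen Step T' M) : T = T' := by
  suffices ∀ (n : ℕ) (M : OrientedBlossomingMap k V D), (M.openingᶜ).ncard = n →
      Relation.ReflTransGen Step T M → Relation.ReflTransGen Step T' M → T = T' from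
    this _ M rfl h h'
  clear h h'
  intro n
  induction n using Nat.strong_induction_on with
  | _ n ih =>
  intro M hn h h'
  by_cases htree : M.IsTree
  · rw [reflTransGen_step_iff] at h h'
    exact ext_of ((htree.eq_of_reflTransGen h.1).trans (htree.eq_of_reflTransGen h'.1).symm)
      (h.2.symm.trans h'.2)
  obtain ⟨b, hb, hc, hw, hr⟩ := exists_removable_edge (isMinimal_of_reflTransGen hT.1 h)
    (isAccessible_of_reflTransGen hT.2 h) htree
  obtain ⟨N, hN, -⟩ :=
    exists_closesAt_of_removable (isAccessible_of_reflTransGen hT.2 h) hb hc hw hr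
  have key : ∀ T : OrientedBlossomingMap k V D, T.IsAccessibleTree →
      Relation.ReflTransGen Step T M → Relation.ReflTransGen Step T N := by
    intro T hT h
    have hne := opp_ne_of_removable hT h hb hc hw hr
    rw [reflTransGen_step_iff] at h ⊢
    obtain ⟨P, hP, hTP⟩ := exists_closesAt_of_reflTransGen h.1
      ((opp_eq_or_of_reflTransGen h.1 b).resolve_left hne) (fun h' => hc (by rwa [h'])) hb
    exact ⟨hN.1.eq_of_right hP ▸ hTP, hN.2.symm.trans h.2⟩
  have hlt : (N.openingᶜ).ncard < n := by
    rw [← hn, hN.1.opening]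
    refine Set.ncard_lt_ncard ⟨Set.compl_subset_compl.2 (Set.subset_insert _ _), fun h => ?_⟩
    exact h hN.1.left_notMem_opening (Set.mem_insert _ _)
  exact ih _ hlt N rfl (key T hT h) (key T' hT' h')

end OrientedBlossomingMap

/-! ### Transport along renamings of vertices and half-edges -/

namespace BlossomingMap

open Equiv Equiv.Perm

variable {V D V' D' : Type u} {M N : BlossomingMap V D} {b c : D}

theorem sameCycle_permCongr_iff {α β : Type*} (g : α ≃ β) (σ : Perm α) (x y : β) :
    (g.permCongr σ).SameCycle x y ↔ σ.SameCycle (g.symm x) (g.symm y) := by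
  have key : ∀ i : ℤ, ((g.permCongr σ) ^ i) x = g ((σ ^ i) (g.symm x)) := fun i => by
    have := map_zpow g.permCongrHom σ i
    exact (Equiv.congr_fun this x).symm
  constructor
  · rintro ⟨i, rfl⟩
    exact ⟨i, by rw [key, Equiv.symm_apply_apply]⟩
  · rintro ⟨i, hi⟩
    exact ⟨i, by rw [key, hi, Equiv.apply_symm_apply]⟩

/-- The same blossoming map with renamed vertices and half-edges. -/
def transport (M : BlossomingMap V D) (f : V ≃ V') (g : D ≃ D') : BlossomingMap V' D' where
  rot := g.permCongr M.rot
  opp := g.permCongr M.opp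
  vert d := f (M.vert (g.symm d))
  root := f M.root
  outer := g.symm ⁻¹' M.outer
  opening := g.symm ⁻¹' M.opening
  opp_opp d := by simp [M.opp_opp]
  vert_eq_iff d d' := by
    rw [sameCycle_permCongr_iff, f.apply_eq_iff_eq, M.vert_eq_iff]
  connected v w := by
    have h := M.connected (f.symm v) (f.symm w)
    have := h.lift (p := fun x y => ∃ d, f (M.vert (g.symm d)) = x ∧
      f (M.vert (g.symm (g.permCongr M.opp d))) = y) f (by
        rintro x y ⟨d, rfl, rfl⟩
        exact ⟨g d, by simp, by simp⟩)
    simpa [Function.onFun] using this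
  euler := by
    have h1 : (g.permCongr M.opp).trans (g.permCongr M.rot) =
        g.permCongr (M.opp.trans M.rot) := by ext d; simp
    rw [h1, ← Nat.card_congr f, ← Nat.card_congr (Quotient.congr (ra := SameCycle.setoid
      (M.opp.trans M.rot)) (rb := SameCycle.setoid (g.permCongr (M.opp.trans M.rot))) g
        fun x y => by
          change _ ↔ (g.permCongr _).SameCycle _ _
          rw [sameCycle_permCongr_iff, g.symm_apply_apply, g.symm_apply_apply]; rfl),
      M.euler, Nat.card_congr (g.subtypeEquiv (p := fun d => M.opp d ≠ d)
        (q := fun d => g.permCongr M.opp d ≠ d) fun d => by simp)]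
  outer_face d hd d' := by
    have h1 : (g.permCongr M.opp).trans (g.permCongr M.rot) =
        g.permCongr (M.opp.trans M.rot) := by ext d; simp
    rw [h1, sameCycle_permCongr_iff]
    exact M.outer_face _ hd _
  outer_nonempty := by
    rintro ⟨d⟩
    obtain ⟨x, hx⟩ := M.outer_nonempty ⟨g.symm d⟩
    exact ⟨g x, by simpa using hx⟩
  opening_stem d hd := by
    simp [M.opening_stem _ hd]
  stem_outer d hd := M.stem_outer _ (by simpa [← Equiv.eq_symm_apply] using hd)

variable (f : V ≃ V') (g : D ≃ D')

theorem transport_rot (d : D') : (M.transport f g).rot d = g (M.rot (g.symm d)) := rfl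

theorem transport_opp (d : D') : (M.transport f g).opp d = g (M.opp (g.symm d)) := rfl

theorem transport_face : (M.transport f g).face = g.permCongr M.face := by
  ext d
  simp [face_apply, transport_rot, transport_opp]

theorem mem_transport_opening (d : D') : d ∈ (M.transport f g).opening ↔ g.symm d ∈ M.opening :=
  Iff.rfl

theorem mem_transport_outer (d : D') : d ∈ (M.transport f g).outer ↔ g.symm d ∈ M.outer :=
  Iff.rfl

theorem IsTree.transport [Finite D] (h : M.IsTree) : (M.transport f g).IsTree := by
  have : Finite D' := Finite.of_equiv D g
  refine isTree_of_sameCycle fun x y => ?_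
  rw [transport_face, sameCycle_permCongr_iff]
  exact h.sameCycle _ _

theorem IsStemless.transport (h : M.IsStemless) : (M.transport f g).IsStemless := fun d hd =>
  h (g.symm d) (by rwa [transport_opp, ← Equiv.eq_symm_apply] at hd)

theorem ClosesAt.transport (h : ClosesAt M N b c) :
    ClosesAt (M.transport f g) (N.transport f g) (g b) (g c) where
  rot := by ext d; rw [transport_rot, transport_rot, h.rot]
  vert := by
    funext d
    change f (N.vert _) = f (M.vert _)
    rw [h.vert]
  root := congrArg f h.root
  opp_left := by simp [transport_opp, h.opp_left]
  opp_right := by simp [transport_opp, h.opp_right]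
  opp_of_ne d hb hc := by
    rw [transport_opp, transport_opp, h.opp_of_ne]
    · exact fun h' => hb (by rw [← h', g.apply_symm_apply])
    · exact fun h' => hc (by rw [← h', g.apply_symm_apply])
  stem_left := by simp [transport_opp, h.stem_left]
  stem_right := by simp [transport_opp, h.stem_right]
  ne := g.injective.ne h.ne
  opening := by
    ext d
    rw [Set.mem_insert_iff, mem_transport_opening, mem_transport_opening, h.opening,
      Set.mem_insert_iff, Equiv.symm_apply_eq]
  left_mem := by simpa [mem_transport_outer] using h.left_mem
  right_notMem := by simpa [mem_transport_outer] using h.right_notMem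

theorem IsStemless.not_closable (h : M.IsStemless) (b c : D) : ¬ M.Closable b c :=
  fun h' => h b (M.opening_stem b h'.1)

end BlossomingMap

namespace OrientedBlossomingMap

open Equiv Equiv.Perm BlossomingMap

variable {k : ℕ} {V D V' D' : Type u} {M N T : OrientedBlossomingMap k V D}
  {M' T' : OrientedBlossomingMap k V' D'}

/-- The same oriented blossoming map with renamed vertices and half-edges. -/
def transport (M : OrientedBlossomingMap k V D) (f : V ≃ V') (g : D ≃ D') :
    OrientedBlossomingMap k V' D' where
  toBlossomingMap := M.toBlossomingMap.transport f g
  weight d := M.weight (g.symm d)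
  weight_edge d hd := by
    rw [transport_opp, g.symm_apply_apply]
    refine M.weight_edge _ fun h => hd ?_
    rw [transport_opp, h, g.apply_symm_apply]
  weight_opening d hd := M.weight_opening _ hd
  weight_closing d hd hd' := by
    rw [transport_opp, ← Equiv.eq_symm_apply] at hd
    exact M.weight_closing _ hd hd'

theorem isomorphic_transport (M : OrientedBlossomingMap k V D) (f : V ≃ V') (g : D ≃ D') :
    M.Isomorphic (M.transport f g) := by
  refine ⟨f, g, fun d => ?_, fun d => ?_, fun d => ?_, rfl, fun d => ?_, fun d => ?_, fun d => ?_⟩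
  · change _ = g (M.rot (g.symm (g d)))
    rw [g.symm_apply_apply]
  · change _ = g (M.opp (g.symm (g d)))
    rw [g.symm_apply_apply]
  · change _ = f (M.vert (g.symm (g d)))
    rw [g.symm_apply_apply]
  · change _ ↔ g.symm (g d) ∈ M.outer
    rw [g.symm_apply_apply]
  · change _ ↔ g.symm (g d) ∈ M.opening
    rw [g.symm_apply_apply]
  · change _ = M.weight (g.symm (g d))
    rw [g.symm_apply_apply]

/-- Isomorphism becomes an equality of structures, so that uniqueness on fixed vertices and
half-edges applies. -/
theorem Isomorphic.exists_eq_transport (h : M.Isomorphic M') :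
    ∃ (f : V ≃ V') (g : D ≃ D'), M' = M.transport f g := by
  obtain ⟨f, g, h1, h2, h3, h4, h5, h6, h7⟩ := h
  refine ⟨f, g, ext_of (BlossomingMap.ext_of ?_ ?_ ?_ h4.symm ?_ ?_) ?_⟩
  · ext d
    change _ = g (M.rot (g.symm d))
    rw [h1, g.apply_symm_apply]
  · ext d
    change _ = g (M.opp (g.symm d))
    rw [h2, g.apply_symm_apply]
  · funext d
    change _ = f (M.vert (g.symm d))
    rw [h3, g.apply_symm_apply]
  · ext d
    change _ ↔ g.symm d ∈ M.outer
    rw [h5, g.apply_symm_apply]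
  · ext d
    change _ ↔ g.symm d ∈ M.opening
    rw [h6, g.apply_symm_apply]
  · funext d
    change _ = M.weight (g.symm d)
    rw [h7, g.apply_symm_apply]

theorem IsAccessibleTree.transport [Finite D] (h : M.IsAccessibleTree) (f : V ≃ V') (g : D ≃ D') :
    (M.transport f g).IsAccessibleTree := by
  refine ⟨h.1.transport f g, fun v => ?_⟩
  have := (h.2 (f.symm v)).lift (p := fun x y => ∃ d, (M.transport f g).opp d ≠ d ∧
    0 < (M.transport f g).weight d ∧ (M.transport f g).vert d = x ∧
    (M.transport f g).vert ((M.transport f g).opp d) = y) f (by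
      rintro x y ⟨d, h1, h2, rfl, rfl⟩
      refine ⟨g d, ?_, ?_, ?_, ?_⟩
      · change g (M.opp (g.symm (g d))) ≠ g d
        rw [g.symm_apply_apply]
        exact g.injective.ne h1
      · change 0 < M.weight (g.symm (g d))
        rwa [g.symm_apply_apply]
      · change f (M.vert (g.symm (g d))) = _
        rw [g.symm_apply_apply]
      · change f (M.vert (g.symm (g (M.opp (g.symm (g d)))))) = _
        rw [g.symm_apply_apply, g.symm_apply_apply])
  rwa [Function.onFun, f.apply_symm_apply] at this

theorem reflTransGen_transport (h : Relation.ReflTransGen Step M N) (f : V ≃ V') (g : D ≃ D') :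
    Relation.ReflTransGen Step (M.transport f g) (N.transport f g) := by
  refine h.lift (fun M => M.transport f g) ?_
  rintro P Q ⟨b, c, h⟩
  exact ⟨g b, g c, h.1.transport f g, funext fun d => congrFun h.2 (g.symm d)⟩

theorem isClosure_iff_of_isStemless [Finite D] (hN : N.IsStemless) :
    M.IsClosure N ↔ Relation.ReflTransGen Step M N := by
  rw [reflTransGen_step_iff]
  exact ⟨fun h => ⟨h.1.1, h.2⟩, fun h => ⟨⟨h.1, hN.not_closable⟩, h.2⟩⟩

theorem IsClosure.unique [Finite D] (h : M.IsClosure N) {N' : OrientedBlossomingMap k V D}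
    (h' : M.IsClosure N') : N = N' :=
  ext_of (BlossomingMap.IsClosure.unique h.1 h'.1) (h.2.trans h'.2.symm)

theorem exists_isClosure [Finite D] (M : OrientedBlossomingMap k V D) :
    ∃ N : OrientedBlossomingMap k V D, M.IsClosure N := by
  obtain ⟨N, hN⟩ := M.toBlossomingMap.exists_isClosure
  obtain ⟨N, rfl, hw, -⟩ := exists_of_reflTransGen hN.1
  exact ⟨N, hN, hw⟩

/-- Closures of trees are isomorphic if and only if the trees are. -/
theorem isomorphic_iff_of_isClosure [Finite V] [Finite D] [Finite V'] [Finite D']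
    (hT : T.IsAccessibleTree) (hT' : T'.IsAccessibleTree) (hM : M.IsStemless)
    (hM' : M'.IsStemless) (h : T.IsClosure M) (h' : T'.IsClosure M') :
    M.Isomorphic M' ↔ T.Isomorphic T' := by
  rw [isClosure_iff_of_isStemless hM] at h
  constructor
  · intro hiso
    obtain ⟨f, g, rfl⟩ := hiso.exists_eq_transport
    rw [isClosure_iff_of_isStemless hM'] at h'
    -- `T'` and the transported `T` are accessible trees with the same closure.
    rw [eq_of_reflTransGen hT' (hT.transport f g) h' (reflTransGen_transport h f g)]
    exact T.isomorphic_transport f g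
  · intro hiso
    obtain ⟨f, g, rfl⟩ := hiso.exists_eq_transport
    have h1 := reflTransGen_transport h f g
    rw [← isClosure_iff_of_isStemless (hM.transport f g)] at h1
    rw [h'.unique h1]
    exact M.isomorphic_transport f g

theorem indeg_transport (f : V ≃ V') (g : D ≃ D') (v : V) :
    (M.transport f g).indeg (f v) = M.indeg v := by
  unfold indeg
  congr 1
  refine (finsum_mem_eq_of_bijOn g ⟨?_, g.injective.injOn, ?_⟩ fun d _ => ?_).symm
  · rintro d rfl
    change f (M.vert (g.symm (g d))) = _
    rw [g.symm_apply_apply]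
  · intro d hd
    exact ⟨g.symm d, f.injective hd, g.apply_symm_apply d⟩
  · rw [inWeight_eq, inWeight_eq]
    change _ = ((k - M.weight (g.symm (g d)) : ℕ) : ℚ)
    rw [g.symm_apply_apply]

theorem outdeg_transport (f : V ≃ V') (g : D ≃ D') (v : V) :
    (M.transport f g).outdeg (f v) = M.outdeg v := by
  unfold outdeg
  congr 1
  refine (finsum_mem_eq_of_bijOn g ⟨?_, g.injective.injOn, ?_⟩ fun d _ => ?_).symm
  · rintro d rfl
    change f (M.vert (g.symm (g d))) = _
    rw [g.symm_apply_apply]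
  · intro d hd
    exact ⟨g.symm d, f.injective hd, g.apply_symm_apply d⟩
  · change _ = (M.weight (g.symm (g d)) : ℚ)
    rw [g.symm_apply_apply]

theorem Isomorphic.degreeDistribution_eq (h : M.Isomorphic M') :
    M.degreeDistribution = M'.degreeDistribution := by
  obtain ⟨f, g, rfl⟩ := h.exists_eq_transport
  funext p
  exact Nat.card_congr (f.subtypeEquiv fun v => by rw [indeg_transport, outdeg_transport])

theorem IsClosure.degrees [Finite D] (h : T.IsClosure M) (v : V) :
    M.indeg v = T.indeg v ∧ M.outdeg v = T.outdeg v :=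
  ⟨indeg_congr (vert_eq_of_reflTransGen h.1.1) h.2 v,
    outdeg_congr (vert_eq_of_reflTransGen h.1.1) h.2 v⟩

theorem existsUnique_tree [Finite V] [Finite D] (hM : M.IsMinimalAccessibleMap) :
    ∃! T : OrientedBlossomingMap k V D, T.IsAccessibleTree ∧ T.IsClosure M := by
  obtain ⟨T, hT, h⟩ := exists_tree hM.2.1 hM.2.2
  refine ⟨T, ⟨hT, (isClosure_iff_of_isStemless hM.1).2 h⟩, fun T' h' => ?_⟩
  exact eq_of_reflTransGen h'.1 hT ((isClosure_iff_of_isStemless hM.1).1 h'.2) h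

theorem IsClosure.isMinimalAccessibleMap [Finite D] (h : T.IsClosure M)
    (hT : T.IsAccessibleTree) (heq : T.HasEqualStems) : M.IsMinimalAccessibleMap := by
  have hs : M.IsStemless := h.1.isStemless heq
  have h' := (isClosure_iff_of_isStemless hs).1 h
  exact ⟨hs, isMinimal_of_reflTransGen hT.1 h', isAccessible_of_reflTransGen hT.2 h'⟩

theorem IsClosure.hasEqualStems [Finite D] (h : T.IsClosure M) (hM : M.IsStemless) :
    T.HasEqualStems :=
  card_opening_eq_of_isStemless h.1.1 hM

end OrientedBlossomingMap

/-! ### The bijection between isomorphism classes -/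

namespace FiniteOrientedMap

open OrientedBlossomingMap

variable {k : ℕ}

/-- The opening of a map: the tree whose closure it is. -/
noncomputable def openTree (X : FiniteOrientedMap.{u} k) (hX : X.map.IsMinimalAccessibleMap) :
    FiniteOrientedMap.{u} k :=
  have := X.finite_V
  have := X.finite_D
  { X with map := (existsUnique_tree hX).choose }

theorem openTree_spec (X : FiniteOrientedMap.{u} k) (hX : X.map.IsMinimalAccessibleMap) :
    ∃ T : OrientedBlossomingMap k X.V X.D, X.openTree hX = { X with map := T } ∧
      T.IsAccessibleTree ∧ T.IsClosure X.map := by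
  have := X.finite_V
  have := X.finite_D
  exact ⟨_, rfl, (existsUnique_tree hX).choose_spec.1⟩

theorem openTree_property (X : FiniteOrientedMap.{u} k) (hX : X.map.IsMinimalAccessibleMap) :
    (X.openTree hX).map.IsAccessibleTree ∧ (X.openTree hX).map.HasEqualStems := by
  have := X.finite_D
  obtain ⟨T, h1, h2, h3⟩ := X.openTree_spec hX
  rw [h1]
  exact ⟨h2, h3.hasEqualStems hX.1⟩

theorem isomorphic_openTree_iff (X : FiniteOrientedMap.{u} k) (hX : X.map.IsMinimalAccessibleMap)
    {V D : Type u} [Finite V] [Finite D] {T M : OrientedBlossomingMap k V D}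
    (hT : T.IsAccessibleTree) (hM : M.IsStemless) (h : T.IsClosure M) :
    M.Isomorphic X.map ↔ T.Isomorphic (X.openTree hX).map := by
  have := X.finite_V
  have := X.finite_D
  obtain ⟨T', h1, h2, h3⟩ := X.openTree_spec hX
  rw [h1]
  exact isomorphic_iff_of_isClosure hT h2 hM hX.1 h h3

theorem isomorphic_iff_openTree (X Y : FiniteOrientedMap.{u} k)
    (hX : X.map.IsMinimalAccessibleMap) (hY : Y.map.IsMinimalAccessibleMap) :
    X.map.Isomorphic Y.map ↔ (X.openTree hX).map.Isomorphic (Y.openTree hY).map := by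
  have := X.finite_V
  have := X.finite_D
  obtain ⟨T, h1, h2, h3⟩ := X.openTree_spec hX
  rw [h1]
  exact isomorphic_openTree_iff Y hY h2 hX.1 h3

/-- The class of the opening of a map. -/
noncomputable def openClass (q : MapClass.{u} k) : TreeClass.{u} k :=
  treeClass (q.2.choose.openTree q.2.choose_spec.1) (openTree_property _ _)

theorem openClass_mapClass (X : FiniteOrientedMap.{u} k) (hX : X.map.IsMinimalAccessibleMap) :
    openClass (mapClass X hX) = treeClass (X.openTree hX) (X.openTree_property hX) := by
  refine Subtype.ext (Quotient.sound ?_)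
  exact (isomorphic_iff_openTree _ _ _ _).1
    (Quotient.exact (mapClass X hX).2.choose_spec.2.symm)

/-- Injective because isomorphic openings have isomorphic closures; surjective because the opening
of the closure of a tree is isomorphic to that tree. -/
theorem openClass_bijective : Function.Bijective (openClass.{u} (k := k)) := by
  constructor
  · rintro ⟨_, X, hX, rfl⟩ ⟨_, Y, hY, rfl⟩ h
    change openClass (mapClass X hX) = openClass (mapClass Y hY) at h
    rw [openClass_mapClass, openClass_mapClass] at h
    exact Subtype.ext (Quotient.sound
      ((isomorphic_iff_openTree _ _ _ _).2 (Quotient.exact (congrArg Subtype.val h))))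
  · rintro ⟨_, Y, hY, rfl⟩
    have := Y.finite_V
    have := Y.finite_D
    obtain ⟨N, hN⟩ := Y.map.exists_isClosure
    have hmin := hN.isMinimalAccessibleMap hY.1 hY.2
    refine ⟨mapClass { Y with map := N } hmin, ?_⟩
    rw [openClass_mapClass]
    refine Subtype.ext (Quotient.sound (Setoid.symm ?_))
    exact (isomorphic_openTree_iff { Y with map := N } hmin hY.1 hmin.1 hN).1
      ((setoid k).refl { Y with map := N })

theorem openClass_eq_iff (X : FiniteOrientedMap.{u} k) (hX : X.map.IsMinimalAccessibleMap)
    (Y : FiniteOrientedMap.{u} k) (hY : Y.map.IsAccessibleTree ∧ Y.map.HasEqualStems) :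
    openClass (mapClass X hX) = treeClass Y hY ↔
      ∃ N : OrientedBlossomingMap k Y.V Y.D, Y.map.IsClosure N ∧ N.Isomorphic X.map := by
  have := Y.finite_V
  have := Y.finite_D
  have h1 : openClass (mapClass X hX) = treeClass Y hY ↔
      Y.map.Isomorphic (X.openTree hX).map := by
    rw [openClass_mapClass]
    exact ⟨fun h => Quotient.exact (congrArg Subtype.val h).symm,
      fun h => Subtype.ext (Quotient.sound (Setoid.symm h))⟩
  rw [h1]
  constructor
  · intro h
    obtain ⟨N, hN⟩ := Y.map.exists_isClosure
    exact ⟨N, hN, (isomorphic_openTree_iff X hX hY.1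
      (hN.isMinimalAccessibleMap hY.1 hY.2).1 hN).2 h⟩
  · rintro ⟨N, hN, h⟩
    exact (isomorphic_openTree_iff X hX hY.1 (hN.isMinimalAccessibleMap hY.1 hY.2).1 hN).1 h

end FiniteOrientedMap

theorem corollary2p2 (k : ℕ) (hk : 1 ≤ k) :
    -- every map is the closure of a unique tree
    (∀ (V D : Type u) [Finite V] [Finite D] (M : OrientedBlossomingMap k V D),
      M.IsMinimalAccessibleMap →
        ∃! T : OrientedBlossomingMap k V D, T.IsAccessibleTree ∧ T.IsClosure M) ∧
    -- every tree with as many opening as closing stems has a unique closure, which is a map with a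
    -- minimal accessible orientation and the same in- and outdegree at every vertex
    (∀ (V D : Type u) [Finite V] [Finite D] (T : OrientedBlossomingMap k V D),
      T.IsAccessibleTree → T.HasEqualStems →
        (∃! M : OrientedBlossomingMap k V D, T.IsClosure M) ∧
        ∀ M : OrientedBlossomingMap k V D, T.IsClosure M → M.IsMinimalAccessibleMap ∧
          ∀ v, M.indeg v = T.indeg v ∧ M.outdeg v = T.outdeg v) ∧
    -- the bijection between isomorphism classes
    (∃ β : FiniteOrientedMap.MapClass.{u} k ≃ FiniteOrientedMap.TreeClass.{u} k,
      ∀ (X : FiniteOrientedMap.{u} k) (hX : X.map.IsMinimalAccessibleMap)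
        (Y : FiniteOrientedMap.{u} k) (hY : Y.map.IsAccessibleTree ∧ Y.map.HasEqualStems),
        (β (FiniteOrientedMap.mapClass X hX) = FiniteOrientedMap.treeClass Y hY ↔
          ∃ N : OrientedBlossomingMap k Y.V Y.D,
            Y.map.IsClosure N ∧ N.Isomorphic X.map) ∧
        (β (FiniteOrientedMap.mapClass X hX) = FiniteOrientedMap.treeClass Y hY →
          X.map.degreeDistribution = Y.map.degreeDistribution)) := by
  refine ⟨fun V D _ _ M hM => OrientedBlossomingMap.existsUnique_tree hM,
    fun V D _ _ T hT heq => ⟨?_, fun M hM => ⟨hM.isMinimalAccessibleMap hT heq, hM.degrees⟩⟩,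
    Equiv.ofBijective _ FiniteOrientedMap.openClass_bijective, fun X hX Y hY => ?_⟩
  · obtain ⟨N, hN⟩ := T.exists_isClosure
    exact ⟨N, hN, fun N' hN' => hN'.unique hN⟩
  · have := Y.finite_D
    have key := FiniteOrientedMap.openClass_eq_iff X hX Y hY
    refine ⟨key, fun h => ?_⟩
    obtain ⟨N, hN, hiso⟩ := key.1 h
    rw [← hiso.degreeDistribution_eq]
    funext p
    simp only [OrientedBlossomingMap.degreeDistribution, hN.degrees]
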